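/- **Theorem (Noether theorem, first part).** Let $M$ be a smooth finite-dimensional manifold, $\pi:E=\mathbb R\times M\to\mathbb R$ the trivial bundle, $k\ge 1$, and let $J^k(E)$ be the manifold of $k$-jets of local sections of $E$, with projections $\pi^k_r:J^k(E)\to J^r(E)$, $\pi^k_0: J^k(E)\to E$ and $t:J^k(E)\to\mathbb R$. The lift of a section $\gamma:I\to E$ ($I\subset\mathbb R$ an open interval) is $\gamma^{(k)}(t)=j^k_t(\gamma)$. *Definitions.* The holonomic distribution $\mathcal D\subset TJ^k(E)$ is, at each $u$, the span of all velocities $\dot\gamma^{(k)}_t$ of lifts of local sections $\gamma$ with $j^k_t(\gamma)=u$. A $p$-form, $p\ge1$, is holonomic if its contraction with every holonomic vector field (i.e. with values in $\mathcal D$) vanishes; a $0$-form is holonomic if it vanishes. Two $p$-forms $\alpha,\alpha'$ on an open set are variationally equivalent if $\alpha-\alpha'=\lambda+d\mu$ with $\lambda,\mu$ holonomic; $[\alpha]$ is the class of $\alpha$. A form is of order $r\le k$ if it is the pull-back by $\pi^k_r$ of a form on an open subset of $J^r(E)$. A $2$-form $\sigma$ is a source form if $\imath_v\sigma=0$ for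 all $v$ with $(\pi^k_0)_*v=0$. If the $1$-form $\alpha$ is locally variationally equivalent to $1$-forms $L\,dt$ of order $r'$ for some $r'\le k/2$, a $1$-form $\alpha_o\in[\alpha]$ is of Poincaré–Cartan type if $d\alpha_o=\sigma+\lambda$ with $\sigma$ a source form and $\lambda$ a holonomic $2$-form. The action is $\mathcal I_{[\alpha]}(\gamma)=\int_{\gamma^{(k)}}\alpha$. If $\alpha$ is of order $r\le k$, a section $\gamma:I\to E$ (with lift in the domain of $\alpha$) satisfies the variational principle if, for all $[a,b]\subset I$ and all smooth variations $\gamma^{s}$, $|s|\le\varepsilon$, of $\gamma^0=\gamma|_{[a,b]}$ by sections with the same $r$-jets as $\gamma$ at $a$ and at $b$, one has $\frac{d}{ds}\big|_{s=0}\int_{(\gamma^{s})^{(k)}([a,b])}\alpha=0$. A smooth function $f$ on an open set $\mathcal U$ is a constant of motion if $\frac{d}{dt}\,f(\gamma^{(k)}(t))=0$ for every such $\gamma$ and every $t\in I$ with $\gamma^{(k)}(t)\in\mathcal U$. A vector field $X$ on $\mathcal U$ is an infinitesimal symmetry for $\mathcal I_{[\alpha]}$ if $\mathcal L_XY$ is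 holonomic for every (locally defined) holonomic vector field $Y$ on $\mathcal U$, and $\mathcal L_X\alpha'$ is holonomic for some $\alpha'\in[\alpha|_{\mathcal U}]$. *Statement.* Let $\mathcal U\subset\mathcal V\subset J^k(E)$ be open (e.g. $\mathcal V=J^k(E)$), let $\alpha$ be a smooth $1$-form of order $r\le k$ on $\mathcal V$, and let $\alpha_o\in[\alpha]$ be a $1$-form of Poincaré–Cartan type on $\mathcal V$. If $X$ is a smooth vector field on $\mathcal U$ that is an infinitesimal symmetry for $\mathcal I_{[\alpha]}$, then $f^{(X)}=\imath_X\alpha_o:\mathcal U\to\mathbb R$ is a constant of motion for the variational principle of $\mathcal I_{[\alpha]}$. -/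

import Mathlib

open Set Filter Manifold VectorField
open scoped Topology ContDiff

noncomputable section

/-! ### Differential forms on a boundaryless manifold `N` modelled on a normed space `G` -/

section Forms

variable {G : Type*} [NormedAddCommGroup G] [NormedSpace ℝ G]
  {N : Type*} [TopologicalSpace N] [ChartedSpace G N] {p : ℕ}

/-- A (not necessarily smooth) field of alternating `p`-linear forms on the tangent spaces. -/
abbrev DiffForm (G : Type*) [NormedAddCommGroup G] [NormedSpace ℝ G]
    (N : Type*) [TopologicalSpace N] [ChartedSpace G N] (p : ℕ) : Type _ :=
  ∀ u : N, TangentSpace 𝓘(ℝ, G) u [⋀^Fin p]→L[ℝ] ℝ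

/-- A (not necessarily smooth) vector field. -/
abbrev VecField (G : Type*) [NormedAddCommGroup G] [NormedSpace ℝ G]
    (N : Type*) [TopologicalSpace N] [ChartedSpace G N] : Type _ :=
  ∀ u : N, TangentSpace 𝓘(ℝ, G) u

/-- The expression of `η` in the preferred chart at `x`, i.e. its pull-back by the inverse chart. -/
def DiffForm.inChart (η : DiffForm G N p) (x : N) (y : G) : G [⋀^Fin p]→L[ℝ] ℝ :=
  (η ((extChartAt 𝓘(ℝ, G) x).symm y)).compContinuousLinearMap
    (mfderiv 𝓘(ℝ, G) 𝓘(ℝ, G) (extChartAt 𝓘(ℝ, G) x).symm y)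

/-- `η` is a smooth `p`-form on `W`. -/
def DiffForm.IsSmoothOn (η : DiffForm G N p) (W : Set N) : Prop :=
  ∀ x : N, ContDiffOn ℝ ∞ (η.inChart x)
    ((extChartAt 𝓘(ℝ, G) x).target ∩ (extChartAt 𝓘(ℝ, G) x).symm ⁻¹' W)

/-- The exterior differential, computed at `u` in the preferred chart at `u`. -/
def DiffForm.d (η : DiffForm G N p) : DiffForm G N (p + 1) := fun u =>
  (extDeriv (η.inChart u) (extChartAt 𝓘(ℝ, G) u u)).compContinuousLinearMap
    (mfderiv 𝓘(ℝ, G) 𝓘(ℝ, G) (extChartAt 𝓘(ℝ, G) u) u)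

/-- The Lie derivative `𝓛_X α` of a 1-form, computed at `u` in the preferred chart at `u`, where it
is `(𝓛_X α)_y (v) = (D_y α (X y)) (v) + α_y (D_y X (v))`, the derivative at time zero of the
pull-back of `α` by the flow of `X`. -/
def DiffForm.lieDeriv (X : VecField G N) (α : DiffForm G N 1) : DiffForm G N 1 := fun u =>
  let A : G → G [⋀^Fin 1]→L[ℝ] ℝ := α.inChart u
  let ξ : G → G := mpullback 𝓘(ℝ, G) 𝓘(ℝ, G) (extChartAt 𝓘(ℝ, G) u).symm X
  let y : G := extChartAt 𝓘(ℝ, G) u u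
  (fderiv ℝ A y (ξ y) + (A y).compContinuousLinearMap (fderiv ℝ ξ y)).compContinuousLinearMap
    (mfderiv 𝓘(ℝ, G) 𝓘(ℝ, G) (extChartAt 𝓘(ℝ, G) u) u)

/-- `X` is a smooth vector field on `W`. -/
def VecField.IsSmoothOn [IsManifold 𝓘(ℝ, G) ∞ N] (X : VecField G N) (W : Set N) : Prop :=
  ContMDiffOn 𝓘(ℝ, G) 𝓘(ℝ, G).tangent ∞ (fun u => (⟨u, X u⟩ : TangentBundle 𝓘(ℝ, G) N)) W

/-- The pull-back of a form by a map. -/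
def DiffForm.pullback {G' : Type*} [NormedAddCommGroup G'] [NormedSpace ℝ G']
    {N' : Type*} [TopologicalSpace N'] [ChartedSpace G' N']
    (f : N → N') (β : DiffForm G' N' p) : DiffForm G N p := fun u =>
  (β (f u)).compContinuousLinearMap (mfderiv 𝓘(ℝ, G) 𝓘(ℝ, G') f u)

end Forms

/-! ### Jets

A section of the trivial bundle `E = ℝ × M → ℝ` over `I ⊆ ℝ` is `t ↦ (t, c t)` for a curve `c` in
`M`, and is represented by `c`. The manifold `M` is modelled on the normed space `F`. -/

section Jets

variable {F : Type*} [NormedAddCommGroup F] [NormedSpace ℝ F]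
  {M : Type*} [TopologicalSpace M] [ChartedSpace F M]

/-- The curve `c` is smooth on a neighbourhood of `t`. -/
def SmoothNear (F : Type*) [NormedAddCommGroup F] [NormedSpace ℝ F]
    {M : Type*} [TopologicalSpace M] [ChartedSpace F M] (c : ℝ → M) (t : ℝ) : Prop :=
  ∀ᶠ s in 𝓝 t, ContMDiffAt 𝓘(ℝ, ℝ) 𝓘(ℝ, F) ∞ c s

/-- A local section of `ℝ × M → ℝ` together with a point of its domain. -/
structure PointedCurve (F : Type*) [NormedAddCommGroup F] [NormedSpace ℝ F]
    (M : Type*) [TopologicalSpace M] [ChartedSpace F M] where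
  time : ℝ
  curve : ℝ → M
  smooth : SmoothNear F curve time

/-- Equality of `k`-jets: same time, same value and same derivatives up to order `k` in the
preferred chart at that value. -/
def jetSetoid (F : Type*) [NormedAddCommGroup F] [NormedSpace ℝ F]
    (M : Type*) [TopologicalSpace M] [ChartedSpace F M] (k : ℕ) : Setoid (PointedCurve F M) where
  r p q := p.time = q.time ∧ p.curve p.time = q.curve q.time ∧
    ∀ a ≤ k, iteratedDeriv a (chartAt F (p.curve p.time) ∘ p.curve) p.time =
      iteratedDeriv a (chartAt F (p.curve p.time) ∘ q.curve) q.time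
  iseqv :=
    { refl := fun _ => ⟨rfl, rfl, fun _ _ => rfl⟩
      symm := fun ⟨h1, h2, h3⟩ => ⟨h1.symm, h2.symm, fun a ha => by rw [← h2, h3 a ha]⟩
      trans := fun ⟨h1, h2, h3⟩ ⟨h1', h2', h3'⟩ =>
        ⟨h1.trans h1', h2.trans h2', fun a ha => by rw [h3 a ha, h2, h3' a ha]⟩ }

/-- The space `J^k(E)` of `k`-jets of local sections of `E = ℝ × M → ℝ`. -/
def JetSpace (F : Type*) [NormedAddCommGroup F] [NormedSpace ℝ F]
    (M : Type*) [TopologicalSpace M] [ChartedSpace F M] (k : ℕ) : Type _ :=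
  Quotient (jetSetoid F M k)

/-- The jet represented by a local section and a point of its domain. -/
def JetSpace.mk (k : ℕ) (p : PointedCurve F M) : JetSpace F M k :=
  Quotient.mk (jetSetoid F M k) p

/-- The space of values of the adapted coordinates `(t, y, y_(1), …, y_(k))`. -/
abbrev JetModel (F : Type*) (k : ℕ) : Type _ := ℝ × (Fin (k + 1) → F)

lemma smoothNear_const (x : M) (t : ℝ) : SmoothNear F (fun _ : ℝ => x) t :=
  Eventually.of_forall fun _ => contMDiffAt_const

open Classical in
/-- The `k`-jet `j^k_t(c)`, as a function of `t` also the lift `c^{(k)}` of `c` to the `k`-th order.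
(It is the jet of the constant curve `c t` if `c` is not smooth near `t`.) -/
def jet (F : Type*) [NormedAddCommGroup F] [NormedSpace ℝ F]
    {M : Type*} [TopologicalSpace M] [ChartedSpace F M] (k : ℕ) (c : ℝ → M) (t : ℝ) :
    JetSpace F M k :=
  if h : SmoothNear F c t then JetSpace.mk k ⟨t, c, h⟩
  else JetSpace.mk k ⟨t, fun _ => c t, smoothNear_const (c t) t⟩

namespace JetSpace

variable {k : ℕ}

/-- The projection `J^k(E) → ℝ`. -/
def time (u : JetSpace F M k) : ℝ :=
  Quotient.lift (fun p : PointedCurve F M => p.time) (fun _ _ (h : (jetSetoid F M k).r _ _) => h.1) u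

/-- The projection `J^k(E) → M`. -/
def point (u : JetSpace F M k) : M :=
  Quotient.lift (fun p : PointedCurve F M => p.curve p.time) (fun _ _ (h : (jetSetoid F M k).r _ _) => h.2.1) u

/-- The projection `J^k(E) → E = ℝ × M`. -/
def toBundle (u : JetSpace F M k) : ℝ × M := (u.time, u.point)

/-- The projection `J^k(E) → J^r(E)`. -/
def proj {r : ℕ} (hr : r ≤ k) (u : JetSpace F M k) : JetSpace F M r :=
  Quotient.map' id (fun _ _ (h : (jetSetoid F M k).r _ _) => ⟨h.1, h.2.1, fun a ha => h.2.2 a (ha.trans hr)⟩) u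

/-- The adapted coordinates `(t, y, y_(1), …, y_(k))` of a jet, for the coordinate map `e` of `M`
(meaningful if `e` is a chart around the base point of the jet). -/
def coord (e : M → F) (u : JetSpace F M k) : JetModel F k :=
  (u.time, fun a => iteratedDeriv a (e ∘ (Quotient.out u).curve) u.time)

end JetSpace

/-- The polynomial curve with derivatives `z.2 0, …, z.2 k` at the time `z.1`. -/
def taylorCurve {k : ℕ} (z : JetModel F k) (s : ℝ) : F :=
  ∑ a : Fin (k + 1), ((s - z.1) ^ (a : ℕ) / (Nat.factorial a : ℝ)) • z.2 a

lemma jet_of_smoothNear {k : ℕ} {c : ℝ → M} {t : ℝ} (h : SmoothNear F c t) :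
    jet F k c t = JetSpace.mk k ⟨t, c, h⟩ := dif_pos h

lemma jet_time {k : ℕ} (c : ℝ → M) (t : ℝ) : (jet F k c t).time = t := by
  by_cases h : SmoothNear F c t
  · rw [jet_of_smoothNear h]; rfl
  · rw [jet, dif_neg h]; rfl

lemma jet_point {k : ℕ} (c : ℝ → M) (t : ℝ) : (jet F k c t).point = c t := by
  by_cases h : SmoothNear F c t
  · rw [jet_of_smoothNear h]; rfl
  · rw [jet, dif_neg h]; rfl

lemma iteratedDeriv_comp_congr {k : ℕ} {φ : F → F} {g h : ℝ → F} {t : ℝ}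
    (hφ : ContDiffAt ℝ k φ (g t)) (hg : ContDiffAt ℝ k g t) (hh : ContDiffAt ℝ k h t)
    (H : ∀ a ≤ k, iteratedDeriv a g t = iteratedDeriv a h t) {a : ℕ} (ha : a ≤ k) :
    iteratedDeriv a (φ ∘ g) t = iteratedDeriv a (φ ∘ h) t := by
  have h0 : g t = h t := by simpa using H 0 (Nat.zero_le k)
  have HF : ∀ b ≤ k, iteratedFDeriv ℝ b g t = iteratedFDeriv ℝ b h t := by
    intro b hb
    rw [iteratedFDeriv_eq_equiv_comp, iteratedFDeriv_eq_equiv_comp]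
    simp [H b hb]
  have ha' : (a : ℕ∞ω) ≤ (k : ℕ∞ω) := by exact_mod_cast ha
  rw [iteratedDeriv_eq_iteratedFDeriv, iteratedDeriv_eq_iteratedFDeriv,
    iteratedFDeriv_comp hφ hg ha', iteratedFDeriv_comp (h0 ▸ hφ) hh ha', ← h0]
  congr 1
  unfold FormalMultilinearSeries.taylorComp
  refine Finset.sum_congr rfl fun c _ => ?_
  ext
  simp only [FormalMultilinearSeries.compAlongOrderedFinpartition_apply]
  congr 1
  ext i
  simp only [OrderedFinpartition.applyOrderedFinpartition_apply, ftaylorSeries]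
  rw [HF _ ((c.partSize_le i).trans ha)]

lemma contDiff_taylorCurve {k : ℕ} :
    ContDiff ℝ ∞ (fun q : JetModel F k × ℝ => taylorCurve q.1 q.2) := by
  unfold taylorCurve
  fun_prop

lemma iteratedDeriv_taylorCurve {k : ℕ} (z : JetModel F k) (a : Fin (k + 1)) :
    iteratedDeriv a (taylorCurve z) z.1 = z.2 a := by
  unfold taylorCurve
  rw [iteratedDeriv_fun_sum (fun i _ => by fun_prop)]
  have key : ∀ b : Fin (k + 1), iteratedDeriv a
      (fun s : ℝ => ((s - z.1) ^ (b : ℕ) / (Nat.factorial b : ℝ)) • z.2 b) z.1 =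
      if b = a then z.2 a else 0 := by
    intro b
    rw [iteratedDeriv_smul_const (by fun_prop), iteratedDeriv_div_const,
      iteratedDeriv_comp_sub_const (f := fun s : ℝ => s ^ (b : ℕ))]
    simp only [sub_self, iteratedDeriv_fun_pow_zero]
    by_cases h : b = a
    · subst h
      have : (Nat.factorial b : ℝ) ≠ 0 := by positivity
      simp [this]
    · have h' : (a : ℕ) ≠ b := fun h2 => h (Fin.ext h2.symm)
      simp [h, h']
  simp [key]

lemma contDiffOn_iteratedDeriv_param {Y : Type*} [NormedAddCommGroup Y] [NormedSpace ℝ Y]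
    {K : Y × ℝ → F} {O : Set (Y × ℝ)} (hO : IsOpen O) (hK : ContDiffOn ℝ ∞ K O) (a : ℕ) :
    ContDiffOn ℝ ∞ (fun q : Y × ℝ => iteratedDeriv a (fun s => K (q.1, s)) q.2) O := by
  induction a with
  | zero => simpa using hK
  | succ a ih =>
    have h1 := (ih.fderiv_of_isOpen hO (m := ∞) (by simp)).clm_apply
      (contDiffOn_const (c := ((0 : Y), (1 : ℝ))))
    refine h1.congr fun q hq => ?_
    have hd := ((ih.contDiffAt (hO.mem_nhds hq)).differentiableAt (by simp)).hasFDerivAt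
    have hl : HasDerivAt (fun s : ℝ => (q.1, s)) ((0 : Y), (1 : ℝ)) q.2 :=
      (hasDerivAt_const _ _).prodMk (hasDerivAt_id _)
    rw [iteratedDeriv_succ]
    exact (hd.comp_hasDerivAt q.2 hl).deriv

lemma SmoothNear.contDiffAt_chart [IsManifold 𝓘(ℝ, F) ∞ M] {c : ℝ → M} {t : ℝ}
    (h : SmoothNear F c t) {e : OpenPartialHomeomorph M F} (he : e ∈ atlas F M)
    (ht : c t ∈ e.source) : ContDiffAt ℝ ∞ (e ∘ c) t := by
  rw [← contMDiffAt_iff_contDiffAt]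
  exact ContMDiffAt.comp t ((contMDiffOn_of_mem_maximalAtlas
    (StructureGroupoid.subset_maximalAtlas _ he)).contMDiffAt (e.open_source.mem_nhds ht))
    h.self_of_nhds

lemma contDiffOn_chart_change [IsManifold 𝓘(ℝ, F) ∞ M] {e e' : OpenPartialHomeomorph M F}
    (he : e ∈ atlas F M) (he' : e' ∈ atlas F M) :
    ContDiffOn ℝ ∞ (e' ∘ e.symm) (e.symm.trans e').source := by
  rw [← contMDiffOn_iff_contDiffOn]
  refine (contMDiffOn_of_mem_maximalAtlas (StructureGroupoid.subset_maximalAtlas _ he')).comp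
    ((contMDiffOn_symm_of_mem_maximalAtlas (StructureGroupoid.subset_maximalAtlas _ he)).mono
      fun y hy => ?_) fun y hy => ?_
  · exact hy.1
  · exact hy.2

/-- Equality of jets does not depend on the chart in which it is tested. -/
lemma iteratedDeriv_chart_congr [IsManifold 𝓘(ℝ, F) ∞ M] {k : ℕ} {c c' : ℝ → M} {t : ℝ}
    (hc : SmoothNear F c t) (hc' : SmoothNear F c' t) (h0 : c t = c' t)
    {e e' : OpenPartialHomeomorph M F} (he : e ∈ atlas F M) (he' : e' ∈ atlas F M)
    (hs : c t ∈ e.source) (hs' : c t ∈ e'.source)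
    (H : ∀ a ≤ k, iteratedDeriv a (e ∘ c) t = iteratedDeriv a (e ∘ c') t) :
    ∀ a ≤ k, iteratedDeriv a (e' ∘ c) t = iteratedDeriv a (e' ∘ c') t := by
  have key : ∀ d : ℝ → M, SmoothNear F d t → d t ∈ e.source →
      e' ∘ d =ᶠ[𝓝 t] (e' ∘ e.symm) ∘ (e ∘ d) := by
    intro d hd hds
    filter_upwards [hd.self_of_nhds.continuousAt.preimage_mem_nhds (e.open_source.mem_nhds hds)]
      with s hs
    simp [e.left_inv hs]
  have hk : ((k : ℕ) : ℕ∞ω) ≤ ∞ := by exact_mod_cast le_top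
  have hφ : ContDiffAt ℝ k (e' ∘ e.symm) ((e ∘ c) t) :=
    ((contDiffOn_chart_change he he').contDiffAt
      ((e.symm.trans e').open_source.mem_nhds (by simp [hs, hs']))).of_le hk
  intro a ha
  rw [(key c hc hs).iteratedDeriv_eq, (key c' hc' (h0 ▸ hs)).iteratedDeriv_eq]
  exact iteratedDeriv_comp_congr hφ ((hc.contDiffAt_chart he hs).of_le hk)
    ((hc'.contDiffAt_chart he (h0 ▸ hs)).of_le hk) H ha

lemma jet_eq_jet [IsManifold 𝓘(ℝ, F) ∞ M] {k : ℕ} {c c' : ℝ → M} {t : ℝ}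
    (hc : SmoothNear F c t) (hc' : SmoothNear F c' t) {e : OpenPartialHomeomorph M F}
    (he : e ∈ atlas F M) (hs : c t ∈ e.source) (h0 : c t = c' t)
    (H : ∀ a ≤ k, iteratedDeriv a (e ∘ c) t = iteratedDeriv a (e ∘ c') t) :
    jet F k c t = jet F k c' t := by
  rw [jet_of_smoothNear hc, jet_of_smoothNear hc']
  exact Quotient.sound ⟨rfl, h0, iteratedDeriv_chart_congr hc hc' h0 he (chart_mem_atlas F _) hs
    (mem_chart_source F _) H⟩

lemma JetSpace.exists_jet {k : ℕ} (u : JetSpace F M k) :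
    SmoothNear F (Quotient.out u).curve u.time ∧ jet F k (Quotient.out u).curve u.time = u := by
  have h : u.time = (Quotient.out u).time := by
    conv_lhs => rw [← Quotient.out_eq u]
    rfl
  rw [h]
  refine ⟨(Quotient.out u).smooth, ?_⟩
  rw [jet_of_smoothNear (Quotient.out u).smooth]
  exact Quotient.out_eq u

/-- The coordinates of `j^k_t(c)` are `(t, c, c', …, c^{(k)})`, computed in the chart of `M`. -/
lemma JetSpace.coord_jet [IsManifold 𝓘(ℝ, F) ∞ M] {k : ℕ} {c : ℝ → M} {t : ℝ}
    (hc : SmoothNear F c t) {e : OpenPartialHomeomorph M F} (he : e ∈ atlas F M)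
    (hs : c t ∈ e.source) :
    (jet F k c t).coord e = (t, fun a : Fin (k + 1) => iteratedDeriv a (e ∘ c) t) := by
  obtain ⟨h1, h2⟩ := (jet F k c t).exists_jet
  have h3 : (jetSetoid F M k).r ⟨_, _, h1⟩ ⟨_, _, hc⟩ := by
    rw [jet_of_smoothNear h1] at h2
    exact Quotient.exact (h2.trans (jet_of_smoothNear hc))
  have ht : (jet F k c t).time = t := jet_time c t
  obtain ⟨-, h4, h5⟩ := h3
  simp only [ht] at h1 h4 h5
  unfold JetSpace.coord
  rw [ht]
  refine Prod.ext rfl (funext fun a => ?_)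
  exact iteratedDeriv_chart_congr h1 hc h4 (chart_mem_atlas F _) he (mem_chart_source F _)
    (h4 ▸ hs) h5 a (Nat.lt_succ_iff.1 a.2)

lemma smoothNear_taylorCurve [IsManifold 𝓘(ℝ, F) ∞ M] {k : ℕ} {e : OpenPartialHomeomorph M F}
    (he : e ∈ atlas F M) {z : JetModel F k} (hz : z.2 0 ∈ e.target) :
    SmoothNear F (e.symm ∘ taylorCurve z) z.1 := by
  have hP : ContDiff ℝ ∞ (taylorCurve z) := by unfold taylorCurve; fun_prop
  have h0 : taylorCurve z z.1 = z.2 0 := by simpa using iteratedDeriv_taylorCurve z 0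
  filter_upwards [hP.continuous.continuousAt.preimage_mem_nhds
    (e.open_target.mem_nhds (h0 ▸ hz : taylorCurve z z.1 ∈ e.target))] with s hs
  exact ContMDiffAt.comp s ((contMDiffOn_symm_of_mem_maximalAtlas
    (StructureGroupoid.subset_maximalAtlas _ he)).contMDiffAt (e.open_target.mem_nhds hs))
    hP.contDiffAt.contMDiffAt

lemma taylorCurve_self {k : ℕ} (z : JetModel F k) : taylorCurve z z.1 = z.2 0 := by
  simpa using iteratedDeriv_taylorCurve z 0

lemma coord_taylorCurve [IsManifold 𝓘(ℝ, F) ∞ M] {k : ℕ} {e : OpenPartialHomeomorph M F}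
    (he : e ∈ atlas F M) {z : JetModel F k} (hz : z.2 0 ∈ e.target) :
    (jet F k (e.symm ∘ taylorCurve z) z.1).coord e = z := by
  have hP : ContDiff ℝ ∞ (taylorCurve z) := by unfold taylorCurve; fun_prop
  rw [JetSpace.coord_jet (smoothNear_taylorCurve he hz) he
    (by simpa [taylorCurve_self] using e.map_target hz)]
  refine Prod.ext rfl (funext fun a => ?_)
  have : e ∘ e.symm ∘ taylorCurve z =ᶠ[𝓝 z.1] taylorCurve z := by
    filter_upwards [hP.continuous.continuousAt.preimage_mem_nhds
      (e.open_target.mem_nhds ((taylorCurve_self z).symm ▸ hz : taylorCurve z z.1 ∈ e.target))]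
      with s hs
    simp [e.right_inv hs]
  change iteratedDeriv a _ _ = _
  rw [this.iteratedDeriv_eq, iteratedDeriv_taylorCurve]

/-- The adapted coordinates of `J^k(E)` associated with a chart `e` of `M`. -/
def jetChart [IsManifold 𝓘(ℝ, F) ∞ M] (k : ℕ) (e : OpenPartialHomeomorph M F)
    (he : e ∈ atlas F M) : PartialEquiv (JetSpace F M k) (JetModel F k) where
  toFun u := u.coord e
  invFun z := jet F k (e.symm ∘ taylorCurve z) z.1
  source := {u | u.point ∈ e.source}
  target := {z | z.2 0 ∈ e.target}
  map_source' u hu := by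
    obtain ⟨h1, h2⟩ := u.exists_jet
    have hp : u.point = (Quotient.out u).curve u.time := by
      conv_lhs => rw [← h2]
      exact jet_point _ _
    simp only [mem_ofPred_eq, JetSpace.coord, Fin.val_zero, iteratedDeriv_zero, Function.comp]
    exact e.map_source (hp ▸ hu)
  map_target' z hz := by
    simp only [mem_ofPred_eq, jet_point, Function.comp, taylorCurve_self]
    exact e.map_target hz
  left_inv' u hu := by
    obtain ⟨h1, h2⟩ := u.exists_jet
    have hp : u.point = (Quotient.out u).curve u.time := by
      conv_lhs => rw [← h2]
      exact jet_point _ _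
    have hs : (Quotient.out u).curve u.time ∈ e.source := hp ▸ hu
    have hz : (u.coord e).2 0 ∈ e.target := by
      simpa [JetSpace.coord] using e.map_source hs
    conv_rhs => rw [← h2]
    have h0 : (e.symm ∘ taylorCurve (u.coord e)) u.time = (Quotient.out u).curve u.time := by
      have : taylorCurve (u.coord e) u.time = (u.coord e).2 0 := taylorCurve_self _
      simp only [Function.comp, this]
      simpa [JetSpace.coord] using e.left_inv hs
    have hsm : SmoothNear F (e.symm ∘ taylorCurve (u.coord e)) u.time :=
      smoothNear_taylorCurve he hz
    refine jet_eq_jet hsm h1 he (h0 ▸ hs) h0 fun a ha => ?_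
    have h3 := coord_taylorCurve he hz
    rw [show (u.coord e).1 = u.time from rfl, JetSpace.coord_jet hsm he (h0 ▸ hs)] at h3
    exact congrFun (congrArg Prod.snd h3) ⟨a, Nat.lt_succ_of_le ha⟩
  right_inv' z hz := coord_taylorCurve he hz

lemma jetChart_change_source [IsManifold 𝓘(ℝ, F) ∞ M] {k : ℕ} {e e' : OpenPartialHomeomorph M F}
    (he : e ∈ atlas F M) (he' : e' ∈ atlas F M) :
    ((jetChart k e he).symm.trans (jetChart k e' he')).source =
      {z : JetModel F k | z.2 0 ∈ (e.symm.trans e').source} := by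
  ext z
  simp [jetChart, jet_point, taylorCurve_self]

lemma contDiffOn_taylorCurve_comp {k : ℕ} {φ : F → F} {S : Set F} (hS : IsOpen S)
    (hφ : ContDiffOn ℝ ∞ φ S) (a : ℕ) :
    ContDiffOn ℝ ∞ (fun z : JetModel F k => iteratedDeriv a (φ ∘ taylorCurve z) z.1)
      {z : JetModel F k | z.2 0 ∈ S} := by
  let K : JetModel F k × ℝ → F := fun q => φ (taylorCurve q.1 q.2)
  let O : Set (JetModel F k × ℝ) := (fun q => taylorCurve q.1 q.2) ⁻¹' S
  have hO : IsOpen O := hS.preimage contDiff_taylorCurve.continuous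
  have hK : ContDiffOn ℝ ∞ K O :=
    ContDiffOn.comp hφ contDiff_taylorCurve.contDiffOn (mapsTo_preimage _ _)
  let ι : JetModel F k → JetModel F k × ℝ := fun z => (z, z.1)
  have hi : ContDiff ℝ ∞ ι := contDiff_id.prodMk contDiff_fst
  have hm : MapsTo ι {z : JetModel F k | z.2 0 ∈ S} O := by
    intro z hz
    have : taylorCurve z z.1 ∈ S := by rw [taylorCurve_self]; exact hz
    exact this
  have h2 := contDiffOn_iteratedDeriv_param hO hK a
  have h3 := h2.comp hi.contDiffOn hm
  have h4 : (fun q : JetModel F k × ℝ => iteratedDeriv a (fun s => K (q.1, s)) q.2) ∘ ι =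
      fun z : JetModel F k => iteratedDeriv a (φ ∘ taylorCurve z) z.1 := funext fun z => rfl
  rw [h4] at h3
  exact h3

lemma contDiffOn_jetChart_change [IsManifold 𝓘(ℝ, F) ∞ M] {k : ℕ}
    {e e' : OpenPartialHomeomorph M F} (he : e ∈ atlas F M) (he' : e' ∈ atlas F M) :
    ContDiffOn ℝ ∞ ((jetChart k e he).symm.trans (jetChart k e' he'))
      ((jetChart k e he).symm.trans (jetChart k e' he')).source := by
  rw [jetChart_change_source]
  have h1 : ContDiffOn ℝ ∞ (fun z : JetModel F k => (z.1, fun a : Fin (k + 1) =>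
      iteratedDeriv a ((e' ∘ e.symm) ∘ taylorCurve z) z.1))
      {z : JetModel F k | z.2 0 ∈ (e.symm.trans e').source} :=
    contDiff_fst.contDiffOn.prodMk (contDiffOn_pi.2 fun a =>
      contDiffOn_taylorCurve_comp (e.symm.trans e').open_source (contDiffOn_chart_change he he') a)
  refine h1.congr fun z hz => ?_
  have hz1 : z.2 0 ∈ e.target := hz.1
  exact JetSpace.coord_jet (smoothNear_taylorCurve he hz1) he'
    (by simpa [taylorCurve_self] using hz.2)

/-- The atlas of adapted coordinates of `J^k(E)`. -/
def jetCore (F : Type*) [NormedAddCommGroup F] [NormedSpace ℝ F]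
    (M : Type*) [TopologicalSpace M] [ChartedSpace F M] [IsManifold 𝓘(ℝ, F) ∞ M] (k : ℕ) :
    ChartedSpaceCore (JetModel F k) (JetSpace F M k) where
  atlas := {f | ∃ (e : OpenPartialHomeomorph M F) (he : e ∈ atlas F M), f = jetChart k e he}
  chartAt u := jetChart k (chartAt F u.point) (chart_mem_atlas F _)
  mem_chart_source u := mem_chart_source F u.point
  chart_mem_atlas u := ⟨_, chart_mem_atlas F u.point, rfl⟩
  open_source := by
    rintro _ _ ⟨e, he, rfl⟩ ⟨e', he', rfl⟩
    rw [jetChart_change_source]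
    exact (e.symm.trans e').open_source.preimage (by fun_prop)
  continuousOn_toFun := by
    rintro _ _ ⟨e, he, rfl⟩ ⟨e', he', rfl⟩
    exact (contDiffOn_jetChart_change he he').continuousOn

variable [IsManifold 𝓘(ℝ, F) ∞ M] {k : ℕ}

instance JetSpace.instTopologicalSpace : TopologicalSpace (JetSpace F M k) :=
  (jetCore F M k).toTopologicalSpace

instance JetSpace.instChartedSpace : ChartedSpace (JetModel F k) (JetSpace F M k) :=
  (jetCore F M k).toChartedSpace

instance JetSpace.instIsManifold : IsManifold 𝓘(ℝ, JetModel F k) ∞ (JetSpace F M k) := by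
  apply isManifold_of_contDiffOn
  intro f f' hf hf'
  obtain ⟨_, hf⟩ := mem_iUnion.1 hf
  obtain ⟨⟨e, he, rfl⟩, rfl⟩ := mem_iUnion.1 hf
  obtain ⟨_, hf'⟩ := mem_iUnion.1 hf'
  obtain ⟨⟨e', he', rfl⟩, rfl⟩ := mem_iUnion.1 hf'
  simp only [modelWithCornersSelf_coe, modelWithCornersSelf_coe_symm, range_id, inter_univ,
    Function.id_comp, Function.comp_id, preimage_id]
  exact contDiffOn_jetChart_change he he'

end Jets

/-! ### Holonomic distribution, variational classes, variational principle, symmetries -/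

section Noether

variable {F : Type*} [NormedAddCommGroup F] [NormedSpace ℝ F]
  {M : Type*} [TopologicalSpace M] [ChartedSpace F M] [IsManifold 𝓘(ℝ, F) ∞ M] {k p : ℕ}

/-- `p`-forms on (open subsets of) `J^k(E)`. -/
abbrev JetForm (F : Type*) [NormedAddCommGroup F] [NormedSpace ℝ F] (M : Type*)
    [TopologicalSpace M] [ChartedSpace F M] [IsManifold 𝓘(ℝ, F) ∞ M] (k p : ℕ) : Type _ :=
  DiffForm (JetModel F k) (JetSpace F M k) p

/-- Vector fields on (open subsets of) `J^k(E)`. -/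
abbrev JetField (F : Type*) [NormedAddCommGroup F] [NormedSpace ℝ F] (M : Type*)
    [TopologicalSpace M] [ChartedSpace F M] [IsManifold 𝓘(ℝ, F) ∞ M] (k : ℕ) : Type _ :=
  VecField (JetModel F k) (JetSpace F M k)

/-- The velocity at `t` of the lift `c^{(k)}` of the curve `c`. -/
def jetVelocity (F : Type*) [NormedAddCommGroup F] [NormedSpace ℝ F]
    {M : Type*} [TopologicalSpace M] [ChartedSpace F M] [IsManifold 𝓘(ℝ, F) ∞ M]
    (k : ℕ) (c : ℝ → M) (t : ℝ) : TangentSpace 𝓘(ℝ, JetModel F k) (jet F k c t) :=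
  mfderiv 𝓘(ℝ, ℝ) 𝓘(ℝ, JetModel F k) (jet F k c) t (1 : ℝ)

/-- The holonomic distribution `𝓓` of `J^k(E)`. -/
def holonomicDistribution (u : JetSpace F M k) :
    Submodule ℝ (TangentSpace 𝓘(ℝ, JetModel F k) u) :=
  Submodule.span ℝ {v | ∃ (c : ℝ → M) (t : ℝ) (h : jet F k c t = u),
    SmoothNear F c t ∧ v = h ▸ jetVelocity F k c t}

/-- `θ` is holonomic on `W`: it vanishes if it is a `0`-form, and its contraction with every
holonomic vector vanishes if it has positive degree. -/
def IsHolonomicOn (W : Set (JetSpace F M k)) : ∀ {p : ℕ}, JetForm F M k p → Prop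
  | 0, θ => ∀ u ∈ W, θ u = 0
  | p + 1, θ => ∀ u ∈ W, ∀ v ∈ holonomicDistribution u,
      ∀ w : Fin p → TangentSpace 𝓘(ℝ, JetModel F k) u, θ u (Matrix.vecCons v w) = 0

/-- `α - α' = θ + dμ` on `W`, with `θ` and `μ` smooth and holonomic on `W`. -/
def VariationallyEquivOn (W : Set (JetSpace F M k)) (α α' : JetForm F M k (p + 1)) : Prop :=
  ∃ (θ : JetForm F M k (p + 1)) (μ : JetForm F M k p),
    θ.IsSmoothOn W ∧ μ.IsSmoothOn W ∧ IsHolonomicOn W θ ∧ IsHolonomicOn W μ ∧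
      ∀ u ∈ W, α u - α' u = θ u + μ.d u

/-- On `W` the form `η` is of order `r`: it is the pull-back of a smooth form that is defined on an
open subset of `J^r(E)`. -/
def IsOfOrderOn {r : ℕ} (hr : r ≤ k) (W : Set (JetSpace F M k)) (η : JetForm F M k p) : Prop :=
  ∃ (W' : Set (JetSpace F M r)) (β : JetForm F M r p), IsOpen W' ∧ β.IsSmoothOn W' ∧
    (∀ u ∈ W, u.proj hr ∈ W') ∧ ∀ u ∈ W, η u = DiffForm.pullback (JetSpace.proj hr) β u

/-- The 1-form `L dt`. -/
def lagrangianForm (L : JetSpace F M k → ℝ) : JetForm F M k 1 := fun u =>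
  L u • ContinuousAlternatingMap.ofSubsingleton ℝ (TangentSpace 𝓘(ℝ, JetModel F k) u) ℝ (0 : Fin 1)
    (mfderiv 𝓘(ℝ, JetModel F k) 𝓘(ℝ, ℝ) (JetSpace.time : JetSpace F M k → ℝ) u)

/-- On `W` the 1-form `α` is locally variationally equivalent to 1-forms `L dt` of order `r`. -/
def IsLocallyLagrangianOn {r : ℕ} (hr : r ≤ k) (W : Set (JetSpace F M k))
    (α : JetForm F M k 1) : Prop :=
  ∀ u ∈ W, ∃ (W' : Set (JetSpace F M k)) (L : JetSpace F M k → ℝ),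
    IsOpen W' ∧ u ∈ W' ∧ W' ⊆ W ∧ ContMDiffOn 𝓘(ℝ, JetModel F k) 𝓘(ℝ, ℝ) ∞ L W' ∧
      IsOfOrderOn hr W' (lagrangianForm L) ∧ VariationallyEquivOn W' α (lagrangianForm L)

/-- `σ` is a source form on `W`: its contraction with every vector tangent to the fibres of
`J^k(E) → E` vanishes. -/
def IsSourceFormOn (W : Set (JetSpace F M k)) (σ : JetForm F M k 2) : Prop :=
  ∀ u ∈ W, ∀ v : TangentSpace 𝓘(ℝ, JetModel F k) u,
    mfderiv 𝓘(ℝ, JetModel F k) (𝓘(ℝ, ℝ).prod 𝓘(ℝ, F))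
      (JetSpace.toBundle : JetSpace F M k → ℝ × M) u v = 0 →
    ∀ w : TangentSpace 𝓘(ℝ, JetModel F k) u, σ u ![v, w] = 0

/-- `αo` is a 1-form of Poincaré–Cartan type in the variational class of `α` on `W`. -/
structure IsPoincareCartanTypeOn (W : Set (JetSpace F M k)) (α αo : JetForm F M k 1) : Prop where
  locallyLagrangian : ∃ (r : ℕ) (hr : r ≤ k), 2 * r ≤ k ∧ IsLocallyLagrangianOn hr W α
  smooth : αo.IsSmoothOn W
  mem_class : VariationallyEquivOn W αo α
  d_eq : ∃ σ θ : JetForm F M k 2, σ.IsSmoothOn W ∧ θ.IsSmoothOn W ∧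
    IsSourceFormOn W σ ∧ IsHolonomicOn W θ ∧ ∀ u ∈ W, αo.d u = σ u + θ u

/-- The smooth vector field `X` on `U` is an infinitesimal symmetry of the holonomic distribution:
`𝓛_X Y = [X, Y]` is holonomic for every holonomic vector field `Y` on an open subset of `U`. -/
def IsDSymmetryOn (U : Set (JetSpace F M k)) (X : JetField F M k) : Prop :=
  ∀ (W : Set (JetSpace F M k)) (Y : JetField F M k), IsOpen W → W ⊆ U → Y.IsSmoothOn W →
    (∀ u ∈ W, Y u ∈ holonomicDistribution u) →
    ∀ u ∈ W, mlieBracket 𝓘(ℝ, JetModel F k) X Y u ∈ holonomicDistribution u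

/-- The vector field `X` on `U` is an infinitesimal symmetry for the action of the variational
class of `α`. -/
structure IsInfinitesimalSymmetryOn (U : Set (JetSpace F M k)) (α : JetForm F M k 1)
    (X : JetField F M k) : Prop where
  smooth : X.IsSmoothOn U
  dSymmetry : IsDSymmetryOn U X
  lieDeriv_holonomic : ∃ α' : JetForm F M k 1, α'.IsSmoothOn U ∧ VariationallyEquivOn U α' α ∧
    IsHolonomicOn U (DiffForm.lieDeriv X α')

/-- The action: the integral of `α` along the lift of `c` to the `k`-th order, over `[a, b]`. -/
def jetAction (α : JetForm F M k 1) (a b : ℝ) (c : ℝ → M) : ℝ :=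
  ∫ t in a..b, α (jet F k c t) ![jetVelocity F k c t]

/-- `Φ (t, s)` is a smooth variation of `c` on `[a, b]` with fixed boundary up to order `r`. -/
def IsVariation (F : Type*) [NormedAddCommGroup F] [NormedSpace ℝ F]
    {M : Type*} [TopologicalSpace M] [ChartedSpace F M]
    (r : ℕ) (a b : ℝ) (c : ℝ → M) (Φ : ℝ × ℝ → M) : Prop :=
  ∃ (ε : ℝ) (O : Set (ℝ × ℝ)), 0 < ε ∧ IsOpen O ∧ Icc a b ×ˢ Icc (-ε) ε ⊆ O ∧
    ContMDiffOn 𝓘(ℝ, ℝ × ℝ) 𝓘(ℝ, F) ∞ Φ O ∧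
    (∀ t ∈ Icc a b, Φ (t, 0) = c t) ∧
    ∀ s ∈ Icc (-ε) ε, jet F r (fun t => Φ (t, s)) a = jet F r c a ∧
      jet F r (fun t => Φ (t, s)) b = jet F r c b

/-- The curve `c` is a section over the open interval `I`, its lift to the `k`-th order has values
in the domain `W` of `α`, and it satisfies the variational principle of the action of `α`, with
respect to the variations with fixed boundary up to order `r`. -/
structure SatisfiesVariationalPrinciple (r : ℕ) (W : Set (JetSpace F M k)) (α : JetForm F M k 1)
    (I : Set ℝ) (c : ℝ → M) : Prop where
  isOpen : IsOpen I
  ordConnected : I.OrdConnected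
  smooth : ContMDiffOn 𝓘(ℝ, ℝ) 𝓘(ℝ, F) ∞ c I
  lift_mem : ∀ t ∈ I, jet F k c t ∈ W
  stationary : ∀ (a b : ℝ) (Φ : ℝ × ℝ → M), a < b → Icc a b ⊆ I → IsVariation F r a b c Φ →
    HasDerivAt (fun s => jetAction α a b (fun t => Φ (t, s))) 0 0

/-- The function `f` on the open set `U` is a constant of motion for the variational principle of
the action of the 1-form `α` of order `r` on `W`. -/
structure IsConstantOfMotionOn (r : ℕ) (W : Set (JetSpace F M k)) (α : JetForm F M k 1)
    (U : Set (JetSpace F M k)) (f : JetSpace F M k → ℝ) : Prop where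
  smooth : ContMDiffOn 𝓘(ℝ, JetModel F k) 𝓘(ℝ, ℝ) ∞ f U
  hasDerivAt_zero : ∀ (I : Set ℝ) (c : ℝ → M), SatisfiesVariationalPrinciple r W α I c →
    ∀ t ∈ I, jet F k c t ∈ U → HasDerivAt (fun s => f (jet F k c s)) 0 t

end Noether
end

/-! Let `c` be a solution, `z` the velocity of its lift, and let `A`, `ξ` be the expressions of
`αo`, `X` in a chart of the jet space. Along the lift, the derivative of `A(ξ)` is `DA(z)[ξ] +
A[Dξ(z)]`, while `(𝓛_X αo)(z) = DA(ξ)[z] + A[Dξ(z)]`. Their difference is `dA(z, ξ)`, which is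
Cartan's formula evaluated on `z`. So it suffices that both `(𝓛_X αo)(z)` and `dαo(·, z)` vanish.

The first is `IsInfinitesimalSymmetryOn.lieDeriv_jetVelocity`. A holonomic `0`-form is zero, so for
`1`-forms variational equivalence is equality modulo holonomic forms. Hence `αo` differs on `U` by a
holonomic `θ` from the form `α'` whose Lie derivative is holonomic. If `Y` is a holonomic field
extending `z`, then `(𝓛_X θ)(Y) = X(θ(Y)) - θ([X, Y])`. Both terms vanish, the second because `X`
preserves the distribution.

The second is the Euler–Lagrange equation `SatisfiesVariationalPrinciple.extDerivContract_eq_zero`,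
proved by splitting the other argument of `dαo` into three parts. On vectors tangent to the fibres
of `J^k(E) → E` the form `dαo = σ + θ` vanishes against `z`, because `σ` is a source form and `z` is
holonomic. On `z` itself it vanishes by alternation. What remains is a displacement of the
coordinate `y` alone. There the first variation along `g + s ψ v`, with `ψ` a bump function, gives
`∫ ψ · dαo((0, v, 0, …), z) = 0`: the derivatives of `ψ` contribute only directions tangent to the
fibres, which have already been dealt with. The fundamental lemma of the calculus of variations
concludes. The action of `α` may be replaced by that of `αo` since the two forms agree on velocities
of lifts. -/

/-! ### Calculus of one-forms on a normed space -/

section OneForms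

variable {G : Type*} [NormedAddCommGroup G] [NormedSpace ℝ G]

/-- Alternating `1`-linear forms as continuous linear functionals. -/
noncomputable def oneFormToDual : (G [⋀^Fin 1]→L[ℝ] ℝ) →L[ℝ] G →L[ℝ] ℝ :=
  (ContinuousAlternatingMap.ofSubsingletonLIE (𝕜 := ℝ) (E := G) (F := ℝ) (0 : Fin 1)).symm.toContinuousLinearEquiv

lemma oneFormToDual_apply (A : G [⋀^Fin 1]→L[ℝ] ℝ) (v : G) : oneFormToDual A v = A ![v] := by
  change A (fun _ => v) = _
  congr 1
  ext i
  fin_cases i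
  rfl

lemma contDiffAt_oneForm_apply {E : Type*} [NormedAddCommGroup E] [NormedSpace ℝ E]
    {n : ℕ∞ω} {A : E → G [⋀^Fin 1]→L[ℝ] ℝ} {ξ : E → G} {y : E} (hA : ContDiffAt ℝ n A y)
    (hξ : ContDiffAt ℝ n ξ y) : ContDiffAt ℝ n (fun z => A z ![ξ z]) y := by
  simp only [← oneFormToDual_apply]
  exact (oneFormToDual.contDiff.contDiffAt.comp y hA).clm_apply hξ

lemma continuousOn_oneForm_apply {E : Type*} [TopologicalSpace E]
    {A : E → G [⋀^Fin 1]→L[ℝ] ℝ} {ξ : E → G} {S : Set E} (hA : ContinuousOn A S)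
    (hξ : ContinuousOn ξ S) : ContinuousOn (fun z => A z ![ξ z]) S := by
  simp only [← oneFormToDual_apply]
  exact (oneFormToDual.continuous.comp_continuousOn hA).clm_apply hξ

lemma hasDerivAt_oneForm_apply {A : ℝ → G [⋀^Fin 1]→L[ℝ] ℝ} {ξ : ℝ → G} {t : ℝ}
    {A' : G [⋀^Fin 1]→L[ℝ] ℝ} {ξ' : G} (hA : HasDerivAt A A' t) (hξ : HasDerivAt ξ ξ' t) :
    HasDerivAt (fun s => A s ![ξ s]) (A' ![ξ t] + A t ![ξ']) t := by
  simp only [← oneFormToDual_apply]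
  exact HasDerivAt.clm_apply (c := fun s => oneFormToDual (A s))
    (oneFormToDual.hasFDerivAt.comp_hasDerivAt t hA) hξ

lemma extDeriv_oneForm_apply (A : G → G [⋀^Fin 1]→L[ℝ] ℝ) (y v w : G) :
    extDeriv A y ![v, w] = fderiv ℝ A y v ![w] - fderiv ℝ A y w ![v] := by
  rw [extDeriv, ContinuousAlternatingMap.alternatizeUncurryFin_apply]
  simp [Fin.sum_univ_two, sub_eq_add_neg]
  congr 1
  ext i
  fin_cases i
  rfl

end OneForms

/-! ### Forms and vector fields read in charts; chart independence of the exterior differential -/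

section FormsInCharts

variable {G : Type*} [NormedAddCommGroup G] [NormedSpace ℝ G]
  {N : Type*} [TopologicalSpace N] [ChartedSpace G N] {p : ℕ}

/-- The differential at `u` of the preferred chart at `x`. -/
noncomputable def chartDeriv (x u : N) : TangentSpace 𝓘(ℝ, G) u →L[ℝ] G :=
  mfderiv 𝓘(ℝ, G) 𝓘(ℝ, G) (extChartAt 𝓘(ℝ, G) x) u

/-- The differential at `y` of the inverse of the preferred chart at `x`. -/
noncomputable def chartSymmDeriv (x : N) (y : G) :
    G →L[ℝ] TangentSpace 𝓘(ℝ, G) ((extChartAt 𝓘(ℝ, G) x).symm y) :=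
  mfderiv 𝓘(ℝ, G) 𝓘(ℝ, G) (extChartAt 𝓘(ℝ, G) x).symm y

/-- The expression of a vector field in the preferred chart at `x`. -/
noncomputable def VecField.inChart (X : VecField G N) (x : N) (y : G) : G :=
  mpullback 𝓘(ℝ, G) 𝓘(ℝ, G) (extChartAt 𝓘(ℝ, G) x).symm X y

lemma DiffForm.inChart_apply (η : DiffForm G N p) (x : N) (y : G) (w : Fin p → G) :
    η.inChart x y w = η ((extChartAt 𝓘(ℝ, G) x).symm y) (fun i => chartSymmDeriv x y (w i)) :=
  rfl

lemma isOpen_chartDomain (x : N) {W : Set N} (hW : IsOpen W) :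
    IsOpen ((extChartAt 𝓘(ℝ, G) x).target ∩ (extChartAt 𝓘(ℝ, G) x).symm ⁻¹' W) :=
  (continuousOn_extChartAt_symm x).isOpen_inter_preimage (isOpen_extChartAt_target x) hW

lemma mem_chartDomain {x u : N} {W : Set N} (hu : u ∈ (extChartAt 𝓘(ℝ, G) x).source)
    (huW : u ∈ W) : extChartAt 𝓘(ℝ, G) x u ∈
      (extChartAt 𝓘(ℝ, G) x).target ∩ (extChartAt 𝓘(ℝ, G) x).symm ⁻¹' W := by
  refine ⟨(extChartAt 𝓘(ℝ, G) x).map_source hu, ?_⟩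
  rwa [mem_preimage, (extChartAt 𝓘(ℝ, G) x).left_inv hu]

lemma DiffForm.IsSmoothOn.contDiffAt {η : DiffForm G N p} {W : Set N} (hη : η.IsSmoothOn W)
    (hW : IsOpen W) {x : N} {y : G} (hy : y ∈ (extChartAt 𝓘(ℝ, G) x).target)
    (hyW : (extChartAt 𝓘(ℝ, G) x).symm y ∈ W) : ContDiffAt ℝ ∞ (η.inChart x) y :=
  (hη x).contDiffAt ((isOpen_chartDomain x hW).mem_nhds ⟨hy, hyW⟩)

variable [IsManifold 𝓘(ℝ, G) ∞ N]

lemma chartDeriv_chartSymmDeriv {x : N} {y : G} (hy : y ∈ (extChartAt 𝓘(ℝ, G) x).target) (w : G) :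
    chartDeriv x _ (chartSymmDeriv x y w) = w := by
  have : IsManifold 𝓘(ℝ, G) 1 N := .of_le (n := ∞) (by simp)
  have h := mfderiv_extChartAt_comp_mfderivWithin_extChartAt_symm hy
  rw [ModelWithCorners.range_eq_univ, mfderivWithin_univ] at h
  exact DFunLike.congr_fun h w

lemma chartSymmDeriv_chartDeriv {x : N} {y : G} (hy : y ∈ (extChartAt 𝓘(ℝ, G) x).target)
    (v : TangentSpace 𝓘(ℝ, G) ((extChartAt 𝓘(ℝ, G) x).symm y)) :
    chartSymmDeriv x y (chartDeriv x _ v) = v := by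
  have : IsManifold 𝓘(ℝ, G) 1 N := .of_le (n := ∞) (by simp)
  have h := mfderivWithin_extChartAt_symm_comp_mfderiv_extChartAt hy
  rw [ModelWithCorners.range_eq_univ, mfderivWithin_univ] at h
  exact DFunLike.congr_fun h v

lemma chartDeriv_injective {x u : N} (hu : u ∈ (extChartAt 𝓘(ℝ, G) x).source) :
    Function.Injective (chartDeriv (G := G) x u) := by
  -- Writing `u` as an inverse-chart value makes the two tangent spaces literally the same, so no
  -- transport along an equality of base points is needed.
  obtain ⟨y, hy, rfl⟩ : ∃ y ∈ (extChartAt 𝓘(ℝ, G) x).target, (extChartAt 𝓘(ℝ, G) x).symm y = u :=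
    ⟨_, (extChartAt 𝓘(ℝ, G) x).map_source hu, (extChartAt 𝓘(ℝ, G) x).left_inv hu⟩
  intro v w h
  rw [← chartSymmDeriv_chartDeriv hy v, h, chartSymmDeriv_chartDeriv hy w]

lemma chartDeriv_surjective {x u : N} (hu : u ∈ (extChartAt 𝓘(ℝ, G) x).source) (w : G) :
    ∃ v, chartDeriv x u v = w := by
  obtain ⟨y, hy, rfl⟩ : ∃ y ∈ (extChartAt 𝓘(ℝ, G) x).target, (extChartAt 𝓘(ℝ, G) x).symm y = u :=
    ⟨_, (extChartAt 𝓘(ℝ, G) x).map_source hu, (extChartAt 𝓘(ℝ, G) x).left_inv hu⟩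
  exact ⟨_, chartDeriv_chartSymmDeriv hy w⟩

lemma DiffForm.inChart_chartDeriv (η : DiffForm G N p) {x u : N}
    (hu : u ∈ (extChartAt 𝓘(ℝ, G) x).source) (v : Fin p → TangentSpace 𝓘(ℝ, G) u) :
    η.inChart x (extChartAt 𝓘(ℝ, G) x u) (fun i => chartDeriv x u (v i)) = η u v := by
  obtain ⟨y, hy, rfl⟩ : ∃ y ∈ (extChartAt 𝓘(ℝ, G) x).target, (extChartAt 𝓘(ℝ, G) x).symm y = u :=
    ⟨_, (extChartAt 𝓘(ℝ, G) x).map_source hu, (extChartAt 𝓘(ℝ, G) x).left_inv hu⟩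
  rw [(extChartAt 𝓘(ℝ, G) x).right_inv hy, DiffForm.inChart_apply]
  simp only [chartSymmDeriv_chartDeriv hy]

lemma DiffForm.inChart_chartDeriv_one (η : DiffForm G N 1) {x u : N}
    (hu : u ∈ (extChartAt 𝓘(ℝ, G) x).source) (v : TangentSpace 𝓘(ℝ, G) u) :
    η.inChart x (extChartAt 𝓘(ℝ, G) x u) ![chartDeriv x u v] = η u ![v] := by
  rw [← η.inChart_chartDeriv hu]
  congr 1
  ext i
  fin_cases i
  rfl

/-- `mpullback` uses `ContinuousLinearMap.inverse`, which is meaningful only for invertible maps. On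
the chart target, `chartDeriv` is a genuine two-sided inverse of `chartSymmDeriv`. -/
lemma VecField.inChart_of_mem_target (X : VecField G N) {x : N} {y : G}
    (hy : y ∈ (extChartAt 𝓘(ℝ, G) x).target) :
    X.inChart x y = chartDeriv x _ (X ((extChartAt 𝓘(ℝ, G) x).symm y)) := by
  have h : ContinuousLinearMap.inverse (chartSymmDeriv x y) = chartDeriv x _ :=
    ContinuousLinearMap.inverse_eq
      (ContinuousLinearMap.ext fun v => chartSymmDeriv_chartDeriv hy v)
      (ContinuousLinearMap.ext fun v => chartDeriv_chartSymmDeriv hy v)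
  exact DFunLike.congr_fun h _

lemma VecField.inChart_chart (X : VecField G N) {x u : N}
    (hu : u ∈ (extChartAt 𝓘(ℝ, G) x).source) :
    X.inChart x (extChartAt 𝓘(ℝ, G) x u) = chartDeriv x u (X u) := by
  rw [X.inChart_of_mem_target ((extChartAt 𝓘(ℝ, G) x).map_source hu),
    (extChartAt 𝓘(ℝ, G) x).left_inv hu]

lemma contDiffAt_chartTransition {x x' : N} {y : G} (hy : y ∈ (extChartAt 𝓘(ℝ, G) x).target)
    (hy' : (extChartAt 𝓘(ℝ, G) x).symm y ∈ (extChartAt 𝓘(ℝ, G) x').source) :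
    ContDiffAt ℝ ∞ (extChartAt 𝓘(ℝ, G) x' ∘ (extChartAt 𝓘(ℝ, G) x).symm) y := by
  rw [← contMDiffAt_iff_contDiffAt]
  exact (contMDiffAt_extChartAt' (by simpa using hy')).comp y
    ((contMDiffOn_extChartAt_symm x).contMDiffAt ((isOpen_extChartAt_target x).mem_nhds hy))

lemma fderiv_chartTransition {x x' : N} {y : G} (hy : y ∈ (extChartAt 𝓘(ℝ, G) x).target)
    (hy' : (extChartAt 𝓘(ℝ, G) x).symm y ∈ (extChartAt 𝓘(ℝ, G) x').source) (w : G) :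
    fderiv ℝ (extChartAt 𝓘(ℝ, G) x' ∘ (extChartAt 𝓘(ℝ, G) x).symm) y w =
      chartDeriv x' _ (chartSymmDeriv x y w) := by
  have : IsManifold 𝓘(ℝ, G) 1 N := .of_le (n := ∞) (by simp)
  have h := mfderiv_comp y (mdifferentiableAt_extChartAt (I := 𝓘(ℝ, G)) (by simpa using hy'))
    (((contMDiffOn_extChartAt_symm (I := 𝓘(ℝ, G)) (n := 1) x).contMDiffAt
      ((isOpen_extChartAt_target x).mem_nhds hy)).mdifferentiableAt (by simp))
  rw [mfderiv_eq_fderiv] at h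
  exact DFunLike.congr_fun h w

/-- The chain rule for the transition map. It reduces chart independence of `d` to the compatibility
of `extDeriv` with pull-backs. -/
lemma DiffForm.inChart_eq_pullback (η : DiffForm G N p) {x x' : N} {y : G}
    (hy : y ∈ (extChartAt 𝓘(ℝ, G) x).target)
    (hy' : (extChartAt 𝓘(ℝ, G) x).symm y ∈ (extChartAt 𝓘(ℝ, G) x').source) :
    η.inChart x y = (η.inChart x' ((extChartAt 𝓘(ℝ, G) x' ∘ (extChartAt 𝓘(ℝ, G) x).symm) y)
      ).compContinuousLinearMap
        (fderiv ℝ (extChartAt 𝓘(ℝ, G) x' ∘ (extChartAt 𝓘(ℝ, G) x).symm) y) := by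
  ext w
  rw [ContinuousAlternatingMap.compContinuousLinearMap_apply, DiffForm.inChart_apply,
    ← η.inChart_chartDeriv hy']
  congr 1
  ext i
  exact (fderiv_chartTransition hy hy' (w i)).symm

/-- The exterior differential can be computed in any preferred chart. -/
lemma DiffForm.d_apply_eq_extDeriv_inChart {η : DiffForm G N p} {W : Set N} (hη : η.IsSmoothOn W)
    (hW : IsOpen W) {x u : N} (hu : u ∈ (extChartAt 𝓘(ℝ, G) x).source) (huW : u ∈ W)
    (v : Fin (p + 1) → TangentSpace 𝓘(ℝ, G) u) :
    η.d u v = extDeriv (η.inChart x) (extChartAt 𝓘(ℝ, G) x u) (fun i => chartDeriv x u (v i)) := by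
  have hy : extChartAt 𝓘(ℝ, G) u u ∈ (extChartAt 𝓘(ℝ, G) u).target := mem_extChartAt_target u
  have hyu : (extChartAt 𝓘(ℝ, G) u).symm (extChartAt 𝓘(ℝ, G) u u) = u := extChartAt_to_inv u
  have hev : η.inChart u =ᶠ[𝓝 (extChartAt 𝓘(ℝ, G) u u)] fun y =>
      (η.inChart x ((extChartAt 𝓘(ℝ, G) x ∘ (extChartAt 𝓘(ℝ, G) u).symm) y)
        ).compContinuousLinearMap
          (fderiv ℝ (extChartAt 𝓘(ℝ, G) x ∘ (extChartAt 𝓘(ℝ, G) u).symm) y) := by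
    filter_upwards [(isOpen_chartDomain u (isOpen_extChartAt_source (I := 𝓘(ℝ, G)) x)).mem_nhds
      (mem_chartDomain (mem_extChartAt_source u) hu)] with y hy
    exact η.inChart_eq_pullback hy.1 hy.2
  have hd : DifferentiableAt ℝ (η.inChart x)
      ((extChartAt 𝓘(ℝ, G) x ∘ (extChartAt 𝓘(ℝ, G) u).symm) (extChartAt 𝓘(ℝ, G) u u)) := by
    rw [Function.comp_apply, hyu]
    refine (hη.contDiffAt hW ((extChartAt 𝓘(ℝ, G) x).map_source hu) ?_).differentiableAt (by simp)
    rwa [(extChartAt 𝓘(ℝ, G) x).left_inv hu]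
  -- The second derivative of the transition map drops out because it is symmetric, which is why a
  -- smoothness bound on that map has to be supplied.
  have h := extDeriv_pullback hd (contDiffAt_chartTransition hy (by rwa [hyu]))
    (by rw [minSmoothness_of_isRCLikeNormedField]; exact WithTop.coe_le_coe.2 le_top)
  have h1 : η.d u v = extDeriv (η.inChart u) (extChartAt 𝓘(ℝ, G) u u)
      (fun i => chartDeriv u u (v i)) := rfl
  rw [h1, hev.extDeriv_eq, h, ContinuousAlternatingMap.compContinuousLinearMap_apply,
    Function.comp_apply, hyu]
  congr 1
  ext i
  rw [Function.comp_apply, fderiv_chartTransition hy (by rwa [hyu])]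
  -- The base point is generalised to `u'` so that the equality of points can be eliminated without
  -- also changing the centre `u` of the chart.
  have h2 : ∀ u' (hu' : u' = (extChartAt 𝓘(ℝ, G) u).symm (extChartAt 𝓘(ℝ, G) u u))
      (v : TangentSpace 𝓘(ℝ, G) u'), chartDeriv x _
        (chartSymmDeriv u (extChartAt 𝓘(ℝ, G) u u) (chartDeriv u u' v)) = chartDeriv x u' v := by
    rintro _ rfl v
    rw [chartSymmDeriv_chartDeriv hy]
  exact h2 u hyu.symm (v i)

lemma VecField.IsSmoothOn.contDiffAt_inChart [CompleteSpace G] {X : VecField G N} {W : Set N}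
    (hX : X.IsSmoothOn W) (hW : IsOpen W) {x : N} {y : G}
    (hy : y ∈ (extChartAt 𝓘(ℝ, G) x).target) (hyW : (extChartAt 𝓘(ℝ, G) x).symm y ∈ W) :
    ContDiffAt ℝ ∞ (X.inChart x) y := by
  have : IsManifold 𝓘(ℝ, G) 1 N := .of_le (n := ∞) (by simp)
  rw [← contMDiffAt_vectorSpace_iff_contDiffAt (V := X.inChart x)]
  refine ContMDiffAt.mpullback_vectorField_preimage (n := ∞) (hX.contMDiffAt (hW.mem_nhds hyW))
    ((contMDiffOn_extChartAt_symm x).contMDiffAt ((isOpen_extChartAt_target x).mem_nhds hy)) ?_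
    (by simp)
  have h := isInvertible_mfderivWithin_extChartAt_symm (I := 𝓘(ℝ, G)) hy
  rwa [ModelWithCorners.range_eq_univ, mfderivWithin_univ] at h

lemma DiffForm.apply_vecField_eq_inChart (η : DiffForm G N 1) (X : VecField G N) {x u : N}
    (hu : u ∈ (extChartAt 𝓘(ℝ, G) x).source) :
    η u ![X u] = η.inChart x (extChartAt 𝓘(ℝ, G) x u)
      ![X.inChart x (extChartAt 𝓘(ℝ, G) x u)] := by
  rw [X.inChart_chart hu, η.inChart_chartDeriv_one hu]

lemma DiffForm.IsSmoothOn.contMDiffOn_apply_vecField [CompleteSpace G] {η : DiffForm G N 1}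
    {X : VecField G N} {W : Set N} (hη : η.IsSmoothOn W) (hX : X.IsSmoothOn W) (hW : IsOpen W) :
    ContMDiffOn 𝓘(ℝ, G) 𝓘(ℝ, ℝ) ∞ (fun u => η u ![X u]) W := by
  intro u hu
  refine ContMDiffAt.contMDiffWithinAt ?_
  have hm := mem_chartDomain (mem_extChartAt_source (I := 𝓘(ℝ, G)) u) hu
  have h : ContDiffAt ℝ ∞ (fun y => η.inChart u y ![X.inChart u y]) (extChartAt 𝓘(ℝ, G) u u) :=
    contDiffAt_oneForm_apply (hη.contDiffAt hW hm.1 hm.2) (hX.contDiffAt_inChart hW hm.1 hm.2)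
  refine (h.contMDiffAt.comp u (contMDiffAt_extChartAt (I := 𝓘(ℝ, G)))).congr_of_eventuallyEq ?_
  filter_upwards [extChartAt_source_mem_nhds (I := 𝓘(ℝ, G)) u] with v hv
  exact η.apply_vecField_eq_inChart X hv

end FormsInCharts

/-! ### Lifts of curves and the holonomic distribution in adapted coordinates -/

section JetsInCharts

variable {F : Type*} [NormedAddCommGroup F] [NormedSpace ℝ F]
  {M : Type*} [TopologicalSpace M] [ChartedSpace F M] {k : ℕ}

lemma SmoothNear.eventually_chart {c : ℝ → M} {t : ℝ} (hc : SmoothNear F c t) {x : M}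
    (ht : c t ∈ (chartAt F x).source) :
    ∀ᶠ s in 𝓝 t, SmoothNear F c s ∧ c s ∈ (chartAt F x).source :=
  (eventually_eventually_nhds.2 hc).and
    (hc.self_of_nhds.continuousAt.preimage_mem_nhds ((chartAt F x).open_source.mem_nhds ht))

variable [IsManifold 𝓘(ℝ, F) ∞ M]

/-- The lift of a curve in a normed space, in adapted coordinates. -/
noncomputable def jetCurve (k : ℕ) (g : ℝ → F) (s : ℝ) : JetModel F k :=
  (s, fun a => iteratedDeriv a g s)

/-- The velocity of the lift of a curve in a normed space, in adapted coordinates. -/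
noncomputable def jetCurveVelocity (k : ℕ) (g : ℝ → F) (s : ℝ) : JetModel F k :=
  (1, fun a => iteratedDeriv (a + 1) g s)

lemma contDiffAt_iteratedDeriv {g : ℝ → F} {t : ℝ} (hg : ContDiffAt ℝ ∞ g t) (a : ℕ) :
    ContDiffAt ℝ ∞ (iteratedDeriv a g) t := by
  rw [iteratedDeriv_eq_equiv_comp]
  exact (LinearIsometryEquiv.contDiff _).contDiffAt.comp t
    (hg.iteratedFDeriv_right (m := ∞) (by exact_mod_cast le_top))

lemma hasDerivAt_jetCurve {g : ℝ → F} {t : ℝ} (hg : ContDiffAt ℝ ∞ g t) :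
    HasDerivAt (jetCurve k g) (jetCurveVelocity k g t) t := by
  refine (hasDerivAt_id t).prodMk (hasDerivAt_pi.2 fun a => ?_)
  rw [iteratedDeriv_succ]
  exact ((contDiffAt_iteratedDeriv hg a).differentiableAt (by simp)).hasDerivAt

lemma jetSpace_mem_chart_source {x u : JetSpace F M k} :
    u ∈ (extChartAt 𝓘(ℝ, JetModel F k) x).source ↔ u.point ∈ (chartAt F x.point).source := by
  rw [extChartAt_source]
  exact Iff.rfl

lemma jetSpace_chart_apply (x u : JetSpace F M k) :
    extChartAt 𝓘(ℝ, JetModel F k) x u = u.coord (chartAt F x.point) := rfl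

lemma jetSpace_mem_chart_target {x : JetSpace F M k} {z : JetModel F k} :
    z ∈ (extChartAt 𝓘(ℝ, JetModel F k) x).target ↔ z.2 0 ∈ (chartAt F x.point).target := by
  rw [extChartAt_target]
  simp only [mfld_simps]
  exact Iff.rfl

lemma extChartAt_jet (x : JetSpace F M k) {c : ℝ → M} {t : ℝ} (hc : SmoothNear F c t)
    (ht : c t ∈ (chartAt F x.point).source) :
    extChartAt 𝓘(ℝ, JetModel F k) x (jet F k c t) = jetCurve k (chartAt F x.point ∘ c) t :=
  JetSpace.coord_jet hc (chart_mem_atlas F _) ht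

lemma jet_mem_chart_source {x : JetSpace F M k} {c : ℝ → M} {t : ℝ}
    (ht : c t ∈ (chartAt F x.point).source) :
    jet F k c t ∈ (extChartAt 𝓘(ℝ, JetModel F k) x).source := by
  rwa [jetSpace_mem_chart_source, jet_point]

lemma jet_eventuallyEq (x : JetSpace F M k) {c : ℝ → M} {t : ℝ} (hc : SmoothNear F c t)
    (ht : c t ∈ (chartAt F x.point).source) :
    jet F k c =ᶠ[𝓝 t] (extChartAt 𝓘(ℝ, JetModel F k) x).symm ∘
      jetCurve k (chartAt F x.point ∘ c) := by
  filter_upwards [hc.eventually_chart ht] with s hs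
  rw [Function.comp_apply, ← extChartAt_jet x hs.1 hs.2, PartialEquiv.left_inv]
  exact jet_mem_chart_source hs.2

/-- Ensures that `jetVelocity` is a true derivative and not the default value zero of `mfderiv`. -/
lemma mdifferentiableAt_jet {c : ℝ → M} {t : ℝ} (hc : SmoothNear F c t) :
    MDifferentiableAt 𝓘(ℝ, ℝ) 𝓘(ℝ, JetModel F k) (jet F k c) t := by
  set x := jet F k c t with hx
  have ht : c t ∈ (chartAt F x.point).source := by
    rw [hx, jet_point]
    exact mem_chart_source F _
  refine MDifferentiableAt.congr_of_eventuallyEq ?_ (jet_eventuallyEq x hc ht)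
  have hm : jetCurve k (chartAt F x.point ∘ c) t ∈ (extChartAt 𝓘(ℝ, JetModel F k) x).target := by
    rw [← extChartAt_jet x hc ht]
    exact (extChartAt 𝓘(ℝ, JetModel F k) x).map_source (jet_mem_chart_source ht)
  refine MDifferentiableAt.comp (I' := 𝓘(ℝ, JetModel F k)) t
    (((contMDiffOn_extChartAt_symm (n := ∞) x).contMDiffAt
      ((isOpen_extChartAt_target x).mem_nhds hm)).mdifferentiableAt (by simp)) ?_
  exact (hasDerivAt_jetCurve (hc.contDiffAt_chart (chart_mem_atlas F _) ht)
    ).differentiableAt.mdifferentiableAt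

lemma chartDeriv_jetVelocity (x : JetSpace F M k) {c : ℝ → M} {t : ℝ} (hc : SmoothNear F c t)
    (ht : c t ∈ (chartAt F x.point).source) :
    chartDeriv x _ (jetVelocity F k c t) = jetCurveVelocity k (chartAt F x.point ∘ c) t := by
  have h1 : extChartAt 𝓘(ℝ, JetModel F k) x ∘ jet F k c =ᶠ[𝓝 t]
      jetCurve k (chartAt F x.point ∘ c) := by
    filter_upwards [hc.eventually_chart ht] with s hs
    exact extChartAt_jet x hs.1 hs.2
  have : IsManifold 𝓘(ℝ, JetModel F k) 1 (JetSpace F M k) := .of_le (n := ∞) (by simp)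
  have h2 := mfderiv_comp t (mdifferentiableAt_extChartAt (I := 𝓘(ℝ, JetModel F k))
    (by simpa using jet_mem_chart_source (k := k) ht)) (mdifferentiableAt_jet (k := k) hc)
  rw [h1.mfderiv_eq, mfderiv_eq_fderiv,
    (hasDerivAt_jetCurve (hc.contDiffAt_chart (chart_mem_atlas F _) ht)).hasFDerivAt.fderiv] at h2
  have h3 := DFunLike.congr_fun h2 (1 : ℝ)
  refine h3.symm.trans ?_
  exact one_smul ℝ _

lemma jetVelocity_mem_holonomicDistribution {c : ℝ → M} {t : ℝ} (hc : SmoothNear F c t) :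
    jetVelocity F k c t ∈ holonomicDistribution (jet F k c t) :=
  Submodule.subset_span ⟨c, t, rfl, hc, rfl⟩

/-- The vector field `∂_t + y_(1) ∂_y + … + y_(k) ∂_{y_(k-1)} + w ∂_{y_(k)}` in adapted
coordinates. -/
def modelHolonomicField (k : ℕ) (w : F) (z : JetModel F k) : JetModel F k :=
  (1, fun a => if h : (a : ℕ) + 1 < k + 1 then z.2 ⟨a + 1, h⟩ else w)

lemma contDiff_modelHolonomicField (w : F) : ContDiff ℝ ∞ (modelHolonomicField k w) := by
  refine contDiff_const.prodMk (contDiff_pi.2 fun a => ?_)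
  by_cases h : (a : ℕ) + 1 < k + 1
  · simp only [h, dif_pos]
    fun_prop
  · simp only [h, dif_neg, not_false_eq_true]
    fun_prop

/-- All components of the velocity but the last are functions of the `k`-jet. The last one is the
derivative of order `k + 1`, which the jet leaves free, and the parameter `w` supplies it. -/
lemma modelHolonomicField_jetCurve (g : ℝ → F) (t : ℝ) :
    modelHolonomicField k (iteratedDeriv (k + 1) g t) (jetCurve k g t) =
      jetCurveVelocity k g t := by
  refine Prod.ext rfl (funext fun a => ?_)
  by_cases h : (a : ℕ) + 1 < k + 1
  · simp only [modelHolonomicField, jetCurve, jetCurveVelocity, dif_pos h]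
  · have : (a : ℕ) = k := by have := a.2; omega
    simp [modelHolonomicField, jetCurveVelocity, this]

/-- Every vector in the range of `modelHolonomicField` is the velocity of a lift. -/
lemma mem_holonomicDistribution_of_chartDeriv {x u : JetSpace F M k}
    (hu : u ∈ (extChartAt 𝓘(ℝ, JetModel F k) x).source) {w : F}
    {v : TangentSpace 𝓘(ℝ, JetModel F k) u}
    (hv : chartDeriv x u v = modelHolonomicField k w (extChartAt 𝓘(ℝ, JetModel F k) x u)) :
    v ∈ holonomicDistribution u := by
  set e := chartAt F x.point with he
  set z := extChartAt 𝓘(ℝ, JetModel F k) x u with hz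
  have hzt : z.2 0 ∈ e.target :=
    jetSpace_mem_chart_target.1 ((extChartAt 𝓘(ℝ, JetModel F k) x).map_source hu)
  -- One order more than the jet: the Taylor curve of `z'` has `k`-jet `z` and derivative `w` of
  -- order `k + 1`, so its lift has the required velocity.
  let z' : JetModel F (k + 1) := (z.1, fun a => if h : (a : ℕ) < k + 1 then z.2 ⟨a, h⟩ else w)
  have hz' : z'.2 0 ∈ e.target := by simpa [z'] using hzt
  set c := e.symm ∘ taylorCurve z' with hcdef
  have hc : SmoothNear F c z.1 := smoothNear_taylorCurve (chart_mem_atlas F _) hz'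
  have hct : c z.1 ∈ e.source := by
    have h0 : taylorCurve z' z.1 = z'.2 0 := taylorCurve_self z'
    rw [hcdef, Function.comp_apply, h0]
    exact e.map_target hz'
  have hder : ∀ a (ha : a < k + 2), iteratedDeriv a (e ∘ c) z.1 = z'.2 ⟨a, ha⟩ := by
    intro a ha
    have h1 := coord_taylorCurve (chart_mem_atlas F _) hz'
    rw [show z'.1 = z.1 from rfl, JetSpace.coord_jet hc (chart_mem_atlas F _) hct] at h1
    exact congrFun (congrArg Prod.snd h1) ⟨a, ha⟩
  have h2 : jetCurve k (e ∘ c) z.1 = z := by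
    refine Prod.ext rfl (funext fun a => ?_)
    have := hder a (by omega)
    simpa [jetCurve, z', a.2] using this
  have h3 : jet F k c z.1 = u := by
    refine (extChartAt 𝓘(ℝ, JetModel F k) x).injOn (jet_mem_chart_source hct) hu ?_
    rw [extChartAt_jet x hc hct, ← hz, ← h2]
    rfl
  clear_value z
  subst h3
  have h4 : v = jetVelocity F k c z.1 := by
    refine chartDeriv_injective hu ?_
    rw [hv, chartDeriv_jetVelocity x hc hct, ← modelHolonomicField_jetCurve]
    rw [show iteratedDeriv (k + 1) (chartAt F x.point ∘ c) z.1 = w by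
      rw [← he, hder (k + 1) (by omega)]; simp [z'], ← he, h2]
  rw [h4]
  exact jetVelocity_mem_holonomicDistribution hc

/-- In adapted coordinates the projection to `E` factors through the linear map `(t, y, y_(1), …) ↦
(t, y)`, called `L` below. This translates the verticality condition in the definition of source
forms into a condition on components. -/
lemma mfderiv_toBundle_eq_zero {x u : JetSpace F M k}
    (hu : u ∈ (extChartAt 𝓘(ℝ, JetModel F k) x).source) {v : TangentSpace 𝓘(ℝ, JetModel F k) u}
    (h1 : (chartDeriv x u v).1 = 0) (h2 : (chartDeriv x u v).2 0 = 0) :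
    mfderiv 𝓘(ℝ, JetModel F k) (𝓘(ℝ, ℝ).prod 𝓘(ℝ, F))
      (JetSpace.toBundle : JetSpace F M k → ℝ × M) u v = 0 := by
  have : IsManifold 𝓘(ℝ, JetModel F k) 1 (JetSpace F M k) := .of_le (n := ∞) (by simp)
  set e := chartAt F x.point with he
  set z := extChartAt 𝓘(ℝ, JetModel F k) x u with hz
  let L : JetModel F k →L[ℝ] ℝ × F := (ContinuousLinearMap.fst ℝ ℝ _).prod
    ((ContinuousLinearMap.proj 0).comp (ContinuousLinearMap.snd ℝ ℝ (Fin (k + 1) → F)))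
  let H : ℝ × F → ℝ × M := fun q => (q.1, e.symm q.2)
  have hev : (JetSpace.toBundle : JetSpace F M k → ℝ × M) =ᶠ[𝓝 u]
      H ∘ (L ∘ extChartAt 𝓘(ℝ, JetModel F k) x) := by
    filter_upwards [(isOpen_extChartAt_source (I := 𝓘(ℝ, JetModel F k)) x).mem_nhds hu] with u' hu'
    obtain ⟨hc, hj⟩ := u'.exists_jet
    have hp : u'.point = (Quotient.out u').curve u'.time := by
      conv_lhs => rw [← hj]
      exact jet_point _ _
    refine Prod.ext rfl ?_
    have hu2 := jetSpace_mem_chart_source.1 hu'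
    simp only [JetSpace.toBundle, H, L, Function.comp_apply, jetSpace_chart_apply, JetSpace.coord,
      ContinuousLinearMap.prod_apply, ContinuousLinearMap.comp_apply,
      ContinuousLinearMap.coe_snd', ContinuousLinearMap.proj_apply, Fin.val_zero,
      iteratedDeriv_zero]
    rw [← hp, he, (chartAt F x.point).left_inv hu2]
  have hzt : z.2 0 ∈ e.target :=
    jetSpace_mem_chart_target.1 ((extChartAt 𝓘(ℝ, JetModel F k) x).map_source hu)
  have hH : MDifferentiableAt 𝓘(ℝ, ℝ × F) (𝓘(ℝ, ℝ).prod 𝓘(ℝ, F)) H (L z) := by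
    refine MDifferentiableAt.prodMk differentiableAt_fst.mdifferentiableAt ?_
    exact MDifferentiableAt.comp (I' := 𝓘(ℝ, F)) (L z)
      (((contMDiffOn_symm_of_mem_maximalAtlas (n := ∞) (StructureGroupoid.subset_maximalAtlas _
        (chart_mem_atlas F x.point))).contMDiffAt (e.open_target.mem_nhds hzt)).mdifferentiableAt
          (by simp)) differentiableAt_snd.mdifferentiableAt
  have hφ : MDifferentiableAt 𝓘(ℝ, JetModel F k) 𝓘(ℝ, JetModel F k)
      (extChartAt 𝓘(ℝ, JetModel F k) x) u := mdifferentiableAt_extChartAt (by simpa using hu)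
  have hL : MDifferentiableAt 𝓘(ℝ, JetModel F k) 𝓘(ℝ, ℝ × F) L z :=
    L.differentiableAt.mdifferentiableAt
  rw [hev.mfderiv_eq]
  have e1 := mfderiv_comp u (f := L ∘ extChartAt 𝓘(ℝ, JetModel F k) x) hH (hL.comp u hφ)
  have e2 := mfderiv_comp u hL hφ
  have e3 : fderiv ℝ L z (chartDeriv x u v) = 0 := by
    rw [L.fderiv]
    exact Prod.ext h1 h2
  rw [mfderiv_eq_fderiv] at e2
  have e4 := (DFunLike.congr_fun e2 v).trans e3
  rw [e1]
  exact (congrArg (mfderiv 𝓘(ℝ, ℝ × F) (𝓘(ℝ, ℝ).prod 𝓘(ℝ, F)) H (L z)) e4).trans (map_zero _)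

end JetsInCharts

/-! ### Vector fields prescribed in a chart, Lie derivatives and brackets in coordinates -/

section VectorFieldsFromCharts

variable {G : Type*} [NormedAddCommGroup G] [NormedSpace ℝ G]
  {N : Type*} [TopologicalSpace N] [ChartedSpace G N]

/-- The vector field whose expression in the preferred chart at `x` is `υ`. -/
noncomputable def VecField.ofChart (x : N) (υ : G → G) : VecField G N :=
  mpullback 𝓘(ℝ, G) 𝓘(ℝ, G) (extChartAt 𝓘(ℝ, G) x) υ

/-- The Lie derivative of a `1`-form, computed in the preferred chart. -/
lemma DiffForm.lieDeriv_apply (X : VecField G N) (η : DiffForm G N 1) (u : N)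
    (v : TangentSpace 𝓘(ℝ, G) u) :
    DiffForm.lieDeriv X η u ![v] =
      fderiv ℝ (η.inChart u) (extChartAt 𝓘(ℝ, G) u u) (X.inChart u (extChartAt 𝓘(ℝ, G) u u))
        ![chartDeriv u u v] +
      η.inChart u (extChartAt 𝓘(ℝ, G) u u)
        ![fderiv ℝ (X.inChart u) (extChartAt 𝓘(ℝ, G) u u) (chartDeriv u u v)] := by
  have h : DiffForm.lieDeriv X η u ![v] =
      fderiv ℝ (η.inChart u) (extChartAt 𝓘(ℝ, G) u u) (X.inChart u (extChartAt 𝓘(ℝ, G) u u))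
        (fun i => chartDeriv u u (![v] i)) +
      η.inChart u (extChartAt 𝓘(ℝ, G) u u)
        (fun i => fderiv ℝ (X.inChart u) (extChartAt 𝓘(ℝ, G) u u) (chartDeriv u u (![v] i))) := rfl
  rw [h]
  congr 2 <;>
  · ext i
    fin_cases i
    rfl

variable [IsManifold 𝓘(ℝ, G) ∞ N]

lemma VecField.chartDeriv_ofChart (υ : G → G) {x u : N}
    (hu : u ∈ (extChartAt 𝓘(ℝ, G) x).source) :
    chartDeriv x u (VecField.ofChart x υ u) = υ (extChartAt 𝓘(ℝ, G) x u) := by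
  have : IsManifold 𝓘(ℝ, G) 1 N := .of_le (n := ∞) (by simp)
  exact (isInvertible_mfderiv_extChartAt (I := 𝓘(ℝ, G)) hu).self_apply_inverse _

lemma VecField.inChart_ofChart (υ : G → G) {x : N} {y : G}
    (hy : y ∈ (extChartAt 𝓘(ℝ, G) x).target) :
    (VecField.ofChart x υ).inChart x y = υ y := by
  rw [VecField.inChart_of_mem_target _ hy,
    VecField.chartDeriv_ofChart υ ((extChartAt 𝓘(ℝ, G) x).map_target hy),
    (extChartAt 𝓘(ℝ, G) x).right_inv hy]

lemma VecField.isSmoothOn_ofChart [CompleteSpace G] {υ : G → G} (hυ : ContDiff ℝ ∞ υ) (x : N) :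
    (VecField.ofChart x υ).IsSmoothOn (extChartAt 𝓘(ℝ, G) x).source := by
  have : IsManifold 𝓘(ℝ, G) 1 N := .of_le (n := ∞) (by simp)
  intro u hu
  refine ContMDiffAt.contMDiffWithinAt ?_
  exact ContMDiffAt.mpullback_vectorField_preimage (n := ∞)
    (contMDiffAt_vectorSpace_iff_contDiffAt.2 hυ.contDiffAt)
    (contMDiffAt_extChartAt' (by simpa using hu)) (isInvertible_mfderiv_extChartAt hu) (by simp)

lemma chartDeriv_mlieBracket (X Y : VecField G N) (x : N) :
    chartDeriv x x (mlieBracket 𝓘(ℝ, G) X Y x) =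
      lieBracket ℝ (X.inChart x) (Y.inChart x) (extChartAt 𝓘(ℝ, G) x x) := by
  have : IsManifold 𝓘(ℝ, G) 1 N := .of_le (n := ∞) (by simp)
  simp only [mlieBracket, mlieBracketWithin, preimage_univ, ModelWithCorners.range_eq_univ,
    univ_inter, mpullbackWithin_univ]
  rw [← lieBracketWithin_univ]
  exact (isInvertible_mfderiv_extChartAt (I := 𝓘(ℝ, G)) (mem_extChartAt_source x)
    ).self_apply_inverse _

end VectorFieldsFromCharts

/-! ### Symmetries of the distribution acting on holonomic forms -/

section Symmetries

variable {F : Type*} [NormedAddCommGroup F] [NormedSpace ℝ F]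
  {M : Type*} [TopologicalSpace M] [ChartedSpace F M] [IsManifold 𝓘(ℝ, F) ∞ M] {k : ℕ}

lemma IsHolonomicOn.apply_eq_zero {W : Set (JetSpace F M k)} {θ : JetForm F M k 1}
    (hθ : IsHolonomicOn W θ) {u : JetSpace F M k} (hu : u ∈ W)
    {v : TangentSpace 𝓘(ℝ, JetModel F k) u} (hv : v ∈ holonomicDistribution u) :
    θ u ![v] = 0 :=
  hθ u hu v hv ![]

/-- A holonomic `0`-form is zero on the whole open set, so its chart expression is locally constant.
For `1`-forms the term `dμ` in variational equivalence is therefore void. -/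
lemma DiffForm.d_eq_zero_of_holonomic {W : Set (JetSpace F M k)} (hW : IsOpen W)
    {μ : JetForm F M k 0} (hμ : IsHolonomicOn W μ) {u : JetSpace F M k} (hu : u ∈ W) :
    μ.d u = 0 := by
  have hev : μ.inChart u =ᶠ[𝓝 (extChartAt 𝓘(ℝ, JetModel F k) u u)] fun _ => 0 := by
    filter_upwards [(isOpen_chartDomain u hW).mem_nhds
      (mem_chartDomain (mem_extChartAt_source u) hu)] with y hy
    ext w
    rw [DiffForm.inChart_apply, hμ _ hy.2]
    rfl
  have h0 : extDeriv (μ.inChart u) (extChartAt 𝓘(ℝ, JetModel F k) u u) = 0 := by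
    rw [hev.extDeriv_eq, extDeriv, fderiv_fun_const]
    ext v
    simp [ContinuousAlternatingMap.alternatizeUncurryFin_apply]
  rw [DiffForm.d, h0]
  rfl

/-- Variationally equivalent `1`-forms agree on holonomic vectors. -/
lemma VariationallyEquivOn.apply_eq {W : Set (JetSpace F M k)} (hW : IsOpen W)
    {α α' : JetForm F M k 1} (h : VariationallyEquivOn W α α') {u : JetSpace F M k} (hu : u ∈ W)
    {v : TangentSpace 𝓘(ℝ, JetModel F k) u} (hv : v ∈ holonomicDistribution u) :
    α u ![v] = α' u ![v] := by
  obtain ⟨θ, μ, -, -, hθ, hμ, h⟩ := h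
  have h1 := h u hu
  rw [DiffForm.d_eq_zero_of_holonomic hW hμ hu, add_zero, sub_eq_iff_eq_add] at h1
  rw [h1, ContinuousAlternatingMap.add_apply, hθ.apply_eq_zero hu hv, zero_add]

/-- The Lie derivative of a holonomic `1`-form along a symmetry of the holonomic distribution
vanishes on velocities of lifts. -/
lemma IsHolonomicOn.lieDeriv_jetVelocity [CompleteSpace F] {U : Set (JetSpace F M k)}
    (hU : IsOpen U) {θ : JetForm F M k 1} (hθs : θ.IsSmoothOn U) (hθ : IsHolonomicOn U θ)
    {X : JetField F M k} (hX : IsDSymmetryOn U X) {c : ℝ → M} {t : ℝ}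
    (hc : SmoothNear F c t) (hcU : jet F k c t ∈ U) :
    DiffForm.lieDeriv X θ (jet F k c t) ![jetVelocity F k c t] = 0 := by
  set x := jet F k c t with hx
  have ht : c t ∈ (chartAt F x.point).source := by
    rw [hx, jet_point]
    exact mem_chart_source F _
  -- Freezing the top derivative at its value at `t` yields a holonomic field on the whole chart
  -- domain that passes through the given velocity at `x`.
  set w := iteratedDeriv (k + 1) (chartAt F x.point ∘ c) t
  set υ := modelHolonomicField k w with hυ
  set y := extChartAt 𝓘(ℝ, JetModel F k) x x with hy
  have hyt : y ∈ (extChartAt 𝓘(ℝ, JetModel F k) x).target := mem_extChartAt_target x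
  have hyU : (extChartAt 𝓘(ℝ, JetModel F k) x).symm y ∈ U := by rwa [hy, extChartAt_to_inv]
  have hvel : chartDeriv x x (jetVelocity F k c t) = υ y := by
    rw [chartDeriv_jetVelocity x hc ht, ← modelHolonomicField_jetCurve, hυ, hy,
      extChartAt_jet x hc ht]
  let Y : JetField F M k := VecField.ofChart x υ
  have hYD : ∀ u ∈ (extChartAt 𝓘(ℝ, JetModel F k) x).source, Y u ∈ holonomicDistribution u :=
    fun u hu => mem_holonomicDistribution_of_chartDeriv hu (VecField.chartDeriv_ofChart υ hu)
  have hbr := hX (U ∩ (extChartAt 𝓘(ℝ, JetModel F k) x).source) Y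
    (hU.inter (isOpen_extChartAt_source x)) inter_subset_left
    ((VecField.isSmoothOn_ofChart (contDiff_modelHolonomicField w) x).mono inter_subset_right)
    (fun u hu => hYD u hu.2) x ⟨hcU, mem_extChartAt_source x⟩
  set ξ := X.inChart x
  set B := θ.inChart x
  have hBd : DifferentiableAt ℝ B y := (hθs.contDiffAt hU hyt hyU).differentiableAt (by simp)
  -- This is `θ([X, Y]) = 0` in the chart, the only use of the symmetry of the distribution.
  have h1 : oneFormToDual (B y) (fderiv ℝ υ y (ξ y) - fderiv ℝ ξ y (υ y)) = 0 := by
    have hev : Y.inChart x =ᶠ[𝓝 y] υ := by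
      filter_upwards [(isOpen_extChartAt_target x).mem_nhds hyt] with z hz
      exact VecField.inChart_ofChart υ hz
    have h := chartDeriv_mlieBracket X Y x
    rw [lieBracket, hev.fderiv_eq, hev.self_of_nhds] at h
    rw [← h, oneFormToDual_apply, θ.inChart_chartDeriv_one (mem_extChartAt_source x)]
    exact hθ.apply_eq_zero hcU hbr
  have h2 : ∀ᶠ z in 𝓝 y, B z ![υ z] = 0 := by
    filter_upwards [(isOpen_chartDomain x hU).mem_nhds ⟨hyt, hyU⟩] with z hz
    have hm := (extChartAt 𝓘(ℝ, JetModel F k) x).map_target hz.1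
    have h := θ.apply_vecField_eq_inChart Y hm
    rw [(extChartAt 𝓘(ℝ, JetModel F k) x).right_inv hz.1, VecField.inChart_ofChart υ hz.1] at h
    rw [← h]
    exact hθ.apply_eq_zero hz.2 (hYD _ hm)
  -- Next, `X(θ(Y)) = 0`: the function `θ(Y)` vanishes near `y`, and it is differentiated along the
  -- straight line with direction `ξ y`, so no flow of `X` is needed.
  have hl : HasDerivAt (fun s : ℝ => y + s • ξ y) (ξ y) 0 := by
    simpa using ((hasDerivAt_id (0 : ℝ)).smul_const (ξ y)).const_add y
  have h0 : y = y + (0 : ℝ) • ξ y := by simp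
  have h3 : HasDerivAt (fun s : ℝ => B (y + s • ξ y) ![υ (y + s • ξ y)])
      (fderiv ℝ B y (ξ y) ![υ y] + B y ![fderiv ℝ υ y (ξ y)]) 0 := by
    have hυd : DifferentiableAt ℝ υ y :=
      (contDiff_modelHolonomicField w).differentiable (by simp) y
    have h := hasDerivAt_oneForm_apply (hBd.hasFDerivAt.comp_hasDerivAt_of_eq 0 hl h0)
      (hυd.hasFDerivAt.comp_hasDerivAt_of_eq 0 hl h0)
    simpa using h
  have h4 : HasDerivAt (fun s : ℝ => B (y + s • ξ y) ![υ (y + s • ξ y)]) 0 0 := by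
    refine (hasDerivAt_const (0 : ℝ) (0 : ℝ)).congr_of_eventuallyEq ?_
    have h6 : Tendsto (fun s : ℝ => y + s • ξ y) (𝓝 0) (𝓝 y) := by
      simpa using hl.continuousAt.tendsto
    exact h6.eventually h2
  have h5 := h3.unique h4
  rw [DiffForm.lieDeriv_apply, hvel]
  rw [map_sub, oneFormToDual_apply, oneFormToDual_apply] at h1
  linarith

/-- The Lie derivative along an infinitesimal symmetry of any `1`-form of the variational class
vanishes on velocities of lifts. -/
lemma IsInfinitesimalSymmetryOn.lieDeriv_jetVelocity [CompleteSpace F]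
    {U V : Set (JetSpace F M k)} (hU : IsOpen U) (hV : IsOpen V) (hUV : U ⊆ V)
    {α β : JetForm F M k 1} (hβs : β.IsSmoothOn V) (hβ : VariationallyEquivOn V β α)
    {X : JetField F M k} (hX : IsInfinitesimalSymmetryOn U α X) {c : ℝ → M} {t : ℝ}
    (hc : SmoothNear F c t) (hcU : jet F k c t ∈ U) :
    DiffForm.lieDeriv X β (jet F k c t) ![jetVelocity F k c t] = 0 := by
  obtain ⟨α', hα's, hα', hL⟩ := hX.lieDeriv_holonomic
  -- The Lie derivative is additive in the form, so the claim for `β` follows from the one for `α'`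
  -- and the vanishing for the holonomic difference.
  let θ : JetForm F M k 1 := fun u => α' u - β u
  have hθc : ∀ x, θ.inChart x = fun y => α'.inChart x y - β.inChart x y := fun x => rfl
  have hθs : θ.IsSmoothOn U := by
    intro x
    rw [hθc]
    exact (hα's x).sub ((hβs x).mono (by gcongr))
  have hθ : IsHolonomicOn U θ := by
    intro u hu v hv w
    rw [Subsingleton.elim w ![]]
    have h := (hα'.apply_eq hU hu hv).trans (hβ.apply_eq hV (hUV hu) hv).symm
    exact sub_eq_zero.2 h
  have h1 := hθ.lieDeriv_jetVelocity hU hθs hX.dSymmetry hc hcU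
  have h2 := hL.apply_eq_zero hcU (jetVelocity_mem_holonomicDistribution hc)
  have hm := mem_chartDomain (mem_extChartAt_source (I := 𝓘(ℝ, JetModel F k)) (jet F k c t)) hcU
  have hd1 : DifferentiableAt ℝ (α'.inChart (jet F k c t)) _ :=
    (hα's.contDiffAt hU hm.1 hm.2).differentiableAt (by simp)
  have hd2 : DifferentiableAt ℝ (β.inChart (jet F k c t)) _ :=
    (hβs.contDiffAt hV hm.1 (hUV hm.2)).differentiableAt (by simp)
  rw [DiffForm.lieDeriv_apply] at h1 h2 ⊢
  rw [hθc, fderiv_fun_sub hd1 hd2] at h1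
  simp only [_root_.sub_apply, ContinuousAlternatingMap.sub_apply] at h1
  linarith

end Symmetries

/-! ### First variation formula and the fundamental lemma of the calculus of variations -/

section FirstVariation

variable {G : Type*} [NormedAddCommGroup G] [NormedSpace ℝ G]

/-- The linear functional `w ↦ dA_y(w, z)`. -/
noncomputable def extDerivContract (A : G → G [⋀^Fin 1]→L[ℝ] ℝ) (y z : G) : G →L[ℝ] ℝ :=
  (oneFormToDual ∘L fderiv ℝ A y).flip z - oneFormToDual (fderiv ℝ A y z)

lemma extDerivContract_apply (A : G → G [⋀^Fin 1]→L[ℝ] ℝ) (y z w : G) :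
    extDerivContract A y z w = extDeriv A y ![w, z] := by
  simp [extDerivContract, extDeriv_oneForm_apply, oneFormToDual_apply]

/-- By alternation. This settles the direction of the velocity itself, whose time component no
variation through sections can produce. -/
lemma extDerivContract_self (A : G → G [⋀^Fin 1]→L[ℝ] ℝ) (y z : G) :
    extDerivContract A y z z = 0 := by
  rw [extDerivContract_apply, extDeriv_oneForm_apply, sub_self]

/-- The first variation of the action of `A` along a straight homotopy with fixed end points. -/
lemma hasDerivAt_integral_oneForm {A : G → G [⋀^Fin 1]→L[ℝ] ℝ} {S : Set G} (hS : IsOpen S)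
    (hA : ContDiffOn ℝ ∞ A S) {Z Z' Ψ Ψ' : ℝ → G} {a b ε : ℝ} (hab : a ≤ b) (hε : 0 < ε)
    (hZ : ∀ t ∈ Icc a b, HasDerivAt Z (Z' t) t) (hΨ : ∀ t ∈ Icc a b, HasDerivAt Ψ (Ψ' t) t)
    (hZ' : ContinuousOn Z' (Icc a b)) (hΨ' : ContinuousOn Ψ' (Icc a b))
    (hm : ∀ t ∈ Icc a b, ∀ s ∈ Icc (-ε) ε, Z t + s • Ψ t ∈ S) (ha : Ψ a = 0) (hb : Ψ b = 0) :
    HasDerivAt (fun s : ℝ => ∫ t in a..b, A (Z t + s • Ψ t) ![Z' t + s • Ψ' t])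
      (∫ t in a..b, extDerivContract A (Z t) (Z' t) (Ψ t)) 0 := by
  have hZc : ContinuousOn Z (Icc a b) := fun t ht => (hZ t ht).continuousAt.continuousWithinAt
  have hΨc : ContinuousOn Ψ (Icc a b) := fun t ht => (hΨ t ht).continuousAt.continuousWithinAt
  have hAd : ∀ y ∈ S, HasFDerivAt A (fderiv ℝ A y) y := fun y hy =>
    ((hA.contDiffAt (hS.mem_nhds hy)).differentiableAt (by simp)).hasFDerivAt
  have hA' : ContinuousOn (fderiv ℝ A) S := hA.continuousOn_fderiv_of_isOpen hS (by simp)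
  let K : Set (ℝ × ℝ) := Icc (-ε) ε ×ˢ Icc a b
  have hK2 : MapsTo Prod.snd K (Icc a b) := fun q hq => hq.2
  have c1 : ContinuousOn (fun q : ℝ × ℝ => Z q.2 + q.1 • Ψ q.2) K :=
    (hZc.comp continuousOn_snd hK2).add (continuousOn_fst.smul (hΨc.comp continuousOn_snd hK2))
  have c2 : ContinuousOn (fun q : ℝ × ℝ => Z' q.2 + q.1 • Ψ' q.2) K :=
    (hZ'.comp continuousOn_snd hK2).add (continuousOn_fst.smul (hΨ'.comp continuousOn_snd hK2))
  have hmK : MapsTo (fun q : ℝ × ℝ => Z q.2 + q.1 • Ψ q.2) K S := fun q hq => hm _ hq.2 _ hq.1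
  let h : ℝ → ℝ → ℝ := fun s t => A (Z t + s • Ψ t) ![Z' t + s • Ψ' t]
  let h' : ℝ → ℝ → ℝ := fun s t => fderiv ℝ A (Z t + s • Ψ t) (Ψ t) ![Z' t + s • Ψ' t] +
    A (Z t + s • Ψ t) ![Ψ' t]
  have hc : ContinuousOn (fun q : ℝ × ℝ => h q.1 q.2) K :=
    continuousOn_oneForm_apply (hA.continuousOn.comp c1 hmK) c2
  have hc' : ContinuousOn (fun q : ℝ × ℝ => h' q.1 q.2) K :=
    (continuousOn_oneForm_apply ((hA'.comp c1 hmK).clm_apply (hΨc.comp continuousOn_snd hK2))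
      c2).add (continuousOn_oneForm_apply (hA.continuousOn.comp c1 hmK)
        (hΨ'.comp continuousOn_snd hK2))
  have hslice : ∀ s ∈ Icc (-ε) ε, MapsTo (fun t : ℝ => (s, t)) (Icc a b) K :=
    fun s hs t ht => ⟨hs, ht⟩
  have hs0 : (0 : ℝ) ∈ Icc (-ε) ε := ⟨by linarith, hε.le⟩
  have hcs : ∀ s ∈ Icc (-ε) ε, ContinuousOn (h s) (Icc a b) := fun s hs =>
    hc.comp (f := fun t : ℝ => (s, t)) (by fun_prop) (hslice s hs)
  have hcs' : ∀ s ∈ Icc (-ε) ε, ContinuousOn (h' s) (Icc a b) := fun s hs =>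
    hc'.comp (f := fun t : ℝ => (s, t)) (by fun_prop) (hslice s hs)
  -- Compactness gives a constant dominating function for differentiation under the integral.
  obtain ⟨C, hC⟩ := (isCompact_Icc.prod isCompact_Icc : IsCompact K).exists_bound_of_continuousOn hc'
  have hIoc : ∀ t ∈ uIoc a b, t ∈ Icc a b := fun t ht =>
    Ioc_subset_Icc_self (by rwa [uIoc_of_le hab] at ht)
  have hnhds : Icc (-ε) ε ∈ 𝓝 (0 : ℝ) := Icc_mem_nhds (by linarith) hε
  have key := (intervalIntegral.hasDerivAt_integral_of_dominated_loc_of_deriv_le (F := h)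
    (F' := h') (μ := MeasureTheory.volume) (a := a) (b := b) (bound := fun _ => C) hnhds
    (by
      filter_upwards [hnhds] with s hs
      rw [uIoc_of_le hab]
      exact ((hcs s hs).mono Ioc_subset_Icc_self).aestronglyMeasurable measurableSet_Ioc)
    ((hcs 0 hs0).intervalIntegrable_of_Icc hab)
    (by
      rw [uIoc_of_le hab]
      exact ((hcs' 0 hs0).mono Ioc_subset_Icc_self).aestronglyMeasurable measurableSet_Ioc)
    (Eventually.of_forall fun t ht s hs => hC (s, t) ⟨hs, hIoc t ht⟩)
    intervalIntegrable_const
    (Eventually.of_forall fun t ht s hs => by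
      have hl : ∀ y v : G, HasDerivAt (fun s : ℝ => y + s • v) v s := fun y v => by
        simpa using ((hasDerivAt_id s).smul_const v).const_add y
      exact hasDerivAt_oneForm_apply
        ((hAd _ (hm t (hIoc t ht) s hs)).comp_hasDerivAt s (hl (Z t) (Ψ t)))
        (hl (Z' t) (Ψ' t)))).2
  refine key.congr_deriv ?_
  have hm0 : MapsTo Z (Icc a b) S := fun t ht => by simpa using hm t ht 0 hs0
  -- Integration by parts: `B` is the derivative of `A(Ψ)` along `Z`, so its integral is zero as `Ψ`
  -- vanishes at the ends. Subtracting it cancels the term in `Ψ'` and leaves `dA(Ψ, Z')`.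
  let B : ℝ → ℝ := fun t => fderiv ℝ A (Z t) (Z' t) ![Ψ t] + A (Z t) ![Ψ' t]
  have hB : ∀ t ∈ uIcc a b, HasDerivAt (fun t => A (Z t) ![Ψ t]) (B t) t := by
    rw [uIcc_of_le hab]
    intro t ht
    exact hasDerivAt_oneForm_apply ((hAd _ (hm0 ht)).comp_hasDerivAt t (hZ t ht)) (hΨ t ht)
  have hBc : ContinuousOn B (Icc a b) :=
    (continuousOn_oneForm_apply ((hA'.comp hZc hm0).clm_apply hZ') hΨc).add
      (continuousOn_oneForm_apply (hA.continuousOn.comp hZc hm0) hΨ')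
  have hBi := intervalIntegral.integral_eq_sub_of_hasDerivAt hB (hBc.intervalIntegrable_of_Icc hab)
  have hz : ∀ y, A y ![(0 : G)] = 0 := fun y => by rw [← oneFormToDual_apply, map_zero]
  rw [ha, hb, hz, hz, sub_zero] at hBi
  refine (sub_zero _).symm.trans ?_
  conv_lhs => rhs; rw [← hBi]
  rw [← intervalIntegral.integral_sub
    ((hcs' 0 hs0).intervalIntegrable_of_Icc hab) (hBc.intervalIntegrable_of_Icc hab)]
  congr 1
  ext t
  simp only [h', B, zero_smul, add_zero, extDerivContract_apply, extDeriv_oneForm_apply]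
  ring

/-- A straight homotopy that starts in an open set stays in it for a short time. -/
lemma exists_forall_add_smul_mem {S : Set G} (hS : IsOpen S) {Z Ψ : ℝ → G} {K : Set ℝ}
    (hK : IsCompact K) (hZ : ContinuousOn Z K) (hΨ : ContinuousOn Ψ K) (hm : MapsTo Z K S) :
    ∃ ε : ℝ, 0 < ε ∧ ∀ t ∈ K, ∀ s ∈ Icc (-ε) ε, Z t + s • Ψ t ∈ S := by
  obtain ⟨δ, hδ, hsub⟩ := (hK.image_of_continuousOn hZ).exists_cthickening_subset_open hS
    hm.image_subset
  obtain ⟨C, hC⟩ := hK.exists_bound_of_continuousOn hΨ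
  -- The bound `C` need not be positive; `|C| + 1` always is.
  refine ⟨δ / (|C| + 1), by positivity, fun t ht s hs => hsub ?_⟩
  refine Metric.mem_cthickening_of_dist_le _ (Z t) δ _ (mem_image_of_mem Z ht) ?_
  rw [dist_eq_norm, add_sub_cancel_left, norm_smul, Real.norm_eq_abs]
  calc |s| * ‖Ψ t‖ ≤ δ / (|C| + 1) * (|C| + 1) := by
        refine mul_le_mul (abs_le.2 hs) ?_ (norm_nonneg _) (by positivity)
        exact ((hC t ht).trans (le_abs_self C)).trans (by linarith)
    _ = δ := by field_simp

/-- A continuous function on an interval is zero at a point if its integrals against all smooth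
functions with small support around the point vanish. -/
lemma eq_zero_of_integral_mul_bump_eq_zero {q : ℝ → ℝ} {t₀ δ₀ : ℝ} (hδ₀ : 0 < δ₀)
    (hq : ContinuousOn q (Icc (t₀ - δ₀) (t₀ + δ₀)))
    (h : ∀ (δ : ℝ) (ψ : ℝ → ℝ), 0 < δ → δ ≤ δ₀ → ContDiff ℝ ∞ ψ →
      (∀ t, δ / 2 < |t - t₀| → ψ t = 0) → ∫ t in (t₀ - δ)..(t₀ + δ), ψ t * q t = 0) :
    q t₀ = 0 := by
  by_contra hne
  have hcont : ContinuousAt q t₀ := hq.continuousAt (Icc_mem_nhds (by linarith) (by linarith))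
  -- The factor `q t₀` treats both signs of `q` at once.
  have hpos : ∀ᶠ t in 𝓝 t₀, 0 < q t₀ * q t :=
    (continuousAt_const.mul hcont).eventually (lt_mem_nhds (mul_self_pos.2 hne))
  obtain ⟨r, hr, hball⟩ := Metric.eventually_nhds_iff.1 hpos
  obtain ⟨δ, hδ, hδr, hδδ⟩ : ∃ δ > 0, δ < r ∧ δ ≤ δ₀ :=
    ⟨min (r / 2) δ₀, by positivity, (min_le_left _ _).trans_lt (by linarith), min_le_right _ _⟩
  let ψ : ContDiffBump t₀ := ⟨δ / 4, δ / 2, by positivity, by linarith⟩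
  have h1 := h δ ψ hδ hδδ ψ.contDiff fun t ht => ψ.zero_of_le_dist (by
    rw [Real.dist_eq]; exact ht.le)
  have hsub : Icc (t₀ - δ) (t₀ + δ) ⊆ Icc (t₀ - δ₀) (t₀ + δ₀) :=
    Icc_subset_Icc (by linarith) (by linarith)
  have h2 : 0 < ∫ t in (t₀ - δ)..(t₀ + δ), q t₀ * (ψ t * q t) := by
    refine intervalIntegral.integral_pos (by linarith)
      (continuousOn_const.mul (ψ.continuous.continuousOn.mul (hq.mono hsub))) ?_ ?_
    · intro t ht
      have h3 : 0 < q t₀ * q t := hball (by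
        rw [Real.dist_eq, abs_lt]; constructor <;> linarith [ht.1, ht.2])
      have h4 := mul_nonneg (ψ.nonneg (x := t)) h3.le
      linarith
    · refine ⟨t₀, ⟨by linarith, by linarith⟩, ?_⟩
      have h5 : ψ t₀ = 1 := ψ.one_of_mem_closedBall (Metric.mem_closedBall_self ψ.rIn_pos.le)
      rw [h5, one_mul]
      exact mul_self_pos.2 hne
  rw [intervalIntegral.integral_const_mul, h1, mul_zero] at h2
  exact lt_irrefl _ h2

end FirstVariation

/-! ### Jets of curves perturbed in a chart -/

lemma chart_comp_symm_comp_eventuallyEq {F M : Type*} [TopologicalSpace F]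
    [TopologicalSpace M] {e : OpenPartialHomeomorph M F} {γ : ℝ → F} {t : ℝ}
    (hγ : ContinuousAt γ t) (ht : γ t ∈ e.target) : e ∘ (e.symm ∘ γ) =ᶠ[𝓝 t] γ := by
  filter_upwards [hγ.preimage_mem_nhds (e.open_target.mem_nhds ht)] with s hs
  exact e.right_inv hs

section JetCongruence

variable {F : Type*} [NormedAddCommGroup F] [NormedSpace ℝ F]
  {M : Type*} [TopologicalSpace M] [ChartedSpace F M]

lemma SmoothNear.congr {c c' : ℝ → M} {t : ℝ} (hc : SmoothNear F c t) (h : c' =ᶠ[𝓝 t] c) :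
    SmoothNear F c' t := by
  filter_upwards [hc, eventually_eventually_nhds.2 h] with s hs hs'
  exact hs.congr_of_eventuallyEq hs'

variable [IsManifold 𝓘(ℝ, F) ∞ M] {k : ℕ}

lemma jet_congr {c c' : ℝ → M} {t : ℝ} (hc : SmoothNear F c t) (h : c' =ᶠ[𝓝 t] c) :
    jet F k c' t = jet F k c t := by
  refine jet_eq_jet (hc.congr h) hc (chart_mem_atlas F (c' t)) (mem_chart_source F _)
    h.self_of_nhds fun a _ => ?_
  exact (h.fun_comp (chartAt F (c' t))).iteratedDeriv_eq a

lemma smoothNear_symm_comp {e : OpenPartialHomeomorph M F} (he : e ∈ atlas F M) {γ : ℝ → F} {t : ℝ}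
    (hγ : ∀ᶠ s in 𝓝 t, ContDiffAt ℝ ∞ γ s) (ht : γ t ∈ e.target) :
    SmoothNear F (e.symm ∘ γ) t := by
  filter_upwards [hγ, hγ.self_of_nhds.continuousAt.preimage_mem_nhds (e.open_target.mem_nhds ht)]
    with s hs hs'
  exact ContMDiffAt.comp s ((contMDiffOn_symm_of_mem_maximalAtlas
    (StructureGroupoid.subset_maximalAtlas _ he)).contMDiffAt (e.open_target.mem_nhds hs'))
    hs.contMDiffAt

lemma jetCurve_congr {g g' : ℝ → F} {t : ℝ} (h : g =ᶠ[𝓝 t] g') :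
    jetCurve k g t = jetCurve k g' t :=
  Prod.ext rfl (funext fun a => h.iteratedDeriv_eq a)

lemma jetCurveVelocity_congr {g g' : ℝ → F} {t : ℝ} (h : g =ᶠ[𝓝 t] g') :
    jetCurveVelocity k g t = jetCurveVelocity k g' t :=
  Prod.ext rfl (funext fun a => h.iteratedDeriv_eq (a + 1))

/-- The lift of a curve in a normed space, without the time component. -/
noncomputable def verticalJetCurve (k : ℕ) (g : ℝ → F) (s : ℝ) : JetModel F k :=
  (0, fun a => iteratedDeriv a g s)

/-- The velocity of the lift of a curve in a normed space, without the time component. -/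
noncomputable def verticalJetCurveVelocity (k : ℕ) (g : ℝ → F) (s : ℝ) : JetModel F k :=
  (0, fun a => iteratedDeriv (a + 1) g s)

lemma iteratedDeriv_add_smul {g η : ℝ → F} {t : ℝ} (hg : ContDiffAt ℝ ∞ g t)
    (hη : ContDiffAt ℝ ∞ η t) (s : ℝ) (a : ℕ) :
    iteratedDeriv a (fun t => g t + s • η t) t = iteratedDeriv a g t + s • iteratedDeriv a η t := by
  have ha : (a : ℕ∞ω) ≤ ∞ := by exact_mod_cast le_top
  have h1 := hg.of_le ha
  have h2 := hη.of_le ha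
  rw [iteratedDeriv_fun_add h1 (h2.const_smul s : ContDiffAt ℝ a (fun t => s • η t) t),
    iteratedDeriv_fun_const_smul_field]

/-- Lifting is affine in the curve once coordinates are fixed, so a straight homotopy of curves
lifts to a straight homotopy, as `hasDerivAt_integral_oneForm` requires. The direction has no time
component because the parametrisation by `t` is kept. -/
lemma jetCurve_add_smul {g η : ℝ → F} {t : ℝ} (hg : ContDiffAt ℝ ∞ g t)
    (hη : ContDiffAt ℝ ∞ η t) (s : ℝ) :
    jetCurve k (fun t => g t + s • η t) t = jetCurve k g t + s • verticalJetCurve k η t := by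
  refine Prod.ext (by simp [jetCurve, verticalJetCurve]) (funext fun a => ?_)
  exact iteratedDeriv_add_smul hg hη s a

lemma jetCurveVelocity_add_smul {g η : ℝ → F} {t : ℝ} (hg : ContDiffAt ℝ ∞ g t)
    (hη : ContDiffAt ℝ ∞ η t) (s : ℝ) :
    jetCurveVelocity k (fun t => g t + s • η t) t =
      jetCurveVelocity k g t + s • verticalJetCurveVelocity k η t := by
  refine Prod.ext (by simp [jetCurveVelocity, verticalJetCurveVelocity]) (funext fun a => ?_)
  exact iteratedDeriv_add_smul hg hη s (a + 1)

lemma hasDerivAt_verticalJetCurve {g : ℝ → F} {t : ℝ} (hg : ContDiffAt ℝ ∞ g t) :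
    HasDerivAt (verticalJetCurve k g) (verticalJetCurveVelocity k g t) t := by
  refine (hasDerivAt_const t 0).prodMk (hasDerivAt_pi.2 fun a => ?_)
  rw [iteratedDeriv_succ]
  exact ((contDiffAt_iteratedDeriv hg a).differentiableAt (by simp)).hasDerivAt

lemma continuousAt_jetCurveVelocity {g : ℝ → F} {t : ℝ} (hg : ContDiffAt ℝ ∞ g t) :
    ContinuousAt (jetCurveVelocity k g) t :=
  continuousAt_const.prodMk (continuousAt_pi.2 fun a =>
    (contDiffAt_iteratedDeriv hg (a + 1)).continuousAt)

lemma continuousAt_verticalJetCurveVelocity {g : ℝ → F} {t : ℝ} (hg : ContDiffAt ℝ ∞ g t) :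
    ContinuousAt (verticalJetCurveVelocity k g) t :=
  continuousAt_const.prodMk (continuousAt_pi.2 fun a =>
    (contDiffAt_iteratedDeriv hg (a + 1)).continuousAt)

lemma verticalJetCurve_eq_zero {g : ℝ → F} {t : ℝ} (h : g =ᶠ[𝓝 t] fun _ => 0) :
    verticalJetCurve k g t = 0 := by
  refine Prod.ext rfl (funext fun a => ?_)
  change iteratedDeriv a g t = 0
  rw [h.iteratedDeriv_eq, iteratedDeriv_fun_const_zero]

end JetCongruence

/-! ### The Euler–Lagrange equations -/

section EulerLagrange

variable {F : Type*} [NormedAddCommGroup F] [NormedSpace ℝ F]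
  {M : Type*} [TopologicalSpace M] [ChartedSpace F M] [IsManifold 𝓘(ℝ, F) ∞ M] {k : ℕ}

/-- For a form `αo` of Poincaré–Cartan type, the contraction of `dαo` with the velocity of a lift
vanishes on the vectors that are tangent to the fibres of `J^k(E) → E`. -/
lemma IsPoincareCartanTypeOn.extDerivContract_eq_zero {V : Set (JetSpace F M k)} (hV : IsOpen V)
    {α αo : JetForm F M k 1} (hαo : IsPoincareCartanTypeOn V α αo) (x : JetSpace F M k)
    {c : ℝ → M} {t : ℝ} (hc : SmoothNear F c t) (ht : c t ∈ (chartAt F x.point).source)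
    (hcV : jet F k c t ∈ V) {w : JetModel F k} (hw1 : w.1 = 0) (hw2 : w.2 0 = 0) :
    extDerivContract (αo.inChart x) (jetCurve k (chartAt F x.point ∘ c) t)
      (jetCurveVelocity k (chartAt F x.point ∘ c) t) w = 0 := by
  obtain ⟨σ, θ, -, -, hσ, hθ, hd⟩ := hαo.d_eq
  have hu := jet_mem_chart_source (k := k) ht
  obtain ⟨v, hv⟩ := chartDeriv_surjective hu w
  rw [extDerivContract_apply, ← extChartAt_jet x hc ht, ← chartDeriv_jetVelocity x hc ht, ← hv]
  have h1 := DiffForm.d_apply_eq_extDeriv_inChart hαo.smooth hV hu hcV ![v, jetVelocity F k c t]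
  have h2 : (fun i => chartDeriv x (jet F k c t) (![v, jetVelocity F k c t] i)) =
      ![chartDeriv x _ v, chartDeriv x _ (jetVelocity F k c t)] := by
    ext1 i
    fin_cases i <;> rfl
  rw [h2] at h1
  rw [← h1, hd _ hcV, ContinuousAlternatingMap.add_apply,
    hσ _ hcV v (mfderiv_toBundle_eq_zero hu (by rw [hv, hw1]) (by rw [hv, hw2])), zero_add]
  have h3 := hθ _ hcV _ (jetVelocity_mem_holonomicDistribution hc) ![v]
  -- Holonomicity is stated for the first slot, whereas the velocity occupies the second.
  have h4 := (θ (jet F k c t)).map_swap ![v, jetVelocity F k c t] (i := 0) (j := 1) (by simp)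
  have h5 : ![v, jetVelocity F k c t] ∘ Equiv.swap (0 : Fin 2) 1 =
      Matrix.vecCons (jetVelocity F k c t) ![v] := by
    ext1 i
    fin_cases i <;> rfl
  rw [h5] at h4
  exact neg_eq_zero.1 (h4.symm.trans h3)

/-- The Euler–Lagrange equations: along a solution of the variational principle, the contraction
of `dαo` with the velocity of the lift vanishes on vertical vectors. -/
lemma SatisfiesVariationalPrinciple.extDerivContract_single_eq_zero {r : ℕ}
    {V : Set (JetSpace F M k)} (hV : IsOpen V) {α αo : JetForm F M k 1}
    (hαo : IsPoincareCartanTypeOn V α αo) {I : Set ℝ} {c : ℝ → M}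
    (hc : SatisfiesVariationalPrinciple r V α I c) (x : JetSpace F M k) {t₀ : ℝ} (ht₀ : t₀ ∈ I)
    (hx : c t₀ ∈ (chartAt F x.point).source) (v : F) :
    extDerivContract (αo.inChart x) (jetCurve k (chartAt F x.point ∘ c) t₀)
      (jetCurveVelocity k (chartAt F x.point ∘ c) t₀) (0, Pi.single 0 v) = 0 := by
  set e := chartAt F x.point with he
  have heA : e ∈ atlas F M := chart_mem_atlas F _
  set g : ℝ → F := e ∘ c with hg
  set A := αo.inChart x with hA
  let S : Set (JetModel F k) := (extChartAt 𝓘(ℝ, JetModel F k) x).target ∩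
    (extChartAt 𝓘(ℝ, JetModel F k) x).symm ⁻¹' V
  have hS : IsOpen S := isOpen_chartDomain x hV
  have hAS : ContDiffOn ℝ ∞ A S := hαo.smooth x
  let J : Set ℝ := I ∩ c ⁻¹' e.source
  have hJ : IsOpen J := hc.smooth.continuousOn.isOpen_inter_preimage hc.isOpen e.open_source
  have hcs : ∀ t ∈ I, SmoothNear F c t := fun t ht =>
    (hc.isOpen.eventually_mem ht).mono fun s hs => hc.smooth.contMDiffAt (hc.isOpen.mem_nhds hs)
  have hgs : ∀ t ∈ J, ContDiffAt ℝ ∞ g t := fun t ht => (hcs t ht.1).contDiffAt_chart heA ht.2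
  have hZS : ∀ t ∈ J, jetCurve k g t ∈ S := fun t ht => by
    rw [hg, ← extChartAt_jet x (hcs t ht.1) ht.2]
    exact mem_chartDomain (jet_mem_chart_source ht.2) (hc.lift_mem t ht.1)
  obtain ⟨δ₁, hδ₁, hball⟩ := Metric.isOpen_iff.1 hJ t₀ ⟨ht₀, hx⟩
  have hsub : ∀ δ, δ ≤ δ₁ / 2 → Icc (t₀ - δ) (t₀ + δ) ⊆ J := fun δ hδ t ht => hball (by
    rw [Metric.mem_ball, Real.dist_eq, abs_lt]
    constructor <;> linarith [ht.1, ht.2])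
  have hZc : ∀ t ∈ J, HasDerivAt (jetCurve k g) (jetCurveVelocity k g t) t := fun t ht =>
    hasDerivAt_jetCurve (hgs t ht)
  have hZ'c : ContinuousOn (jetCurveVelocity k g) J := fun t ht =>
    (continuousAt_jetCurveVelocity (hgs t ht)).continuousWithinAt
  -- Only times near `t₀` are varied, so that everything happens in a single chart. Half of the
  -- radius `δ₁` keeps the closed interval inside the ball.
  refine eq_zero_of_integral_mul_bump_eq_zero (t₀ := t₀) (q := fun t =>
    extDerivContract A (jetCurve k g t) (jetCurveVelocity k g t) (0, Pi.single 0 v))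
    (half_pos hδ₁) ?_ ?_
  · refine ContinuousOn.mono (s := J) ?_ (hsub _ le_rfl)
    have hA' : ContinuousOn (fun t => fderiv ℝ A (jetCurve k g t)) J :=
      (hAS.continuousOn_fderiv_of_isOpen hS (by simp)).comp
        (fun t ht => (hZc t ht).continuousAt.continuousWithinAt) hZS
    simp only [extDerivContract_apply, extDeriv_oneForm_apply]
    exact (continuousOn_oneForm_apply (hA'.clm_apply continuousOn_const) hZ'c).sub
      (continuousOn_oneForm_apply (hA'.clm_apply hZ'c) continuousOn_const)
  intro δ ψ hδ hδ' hψ hψ0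
  set a := t₀ - δ with ha
  set b := t₀ + δ with hb
  have hab : a < b := by linarith
  have hKJ : Icc a b ⊆ J := hsub δ hδ'
  have haJ : a ∈ J := hKJ ⟨le_rfl, hab.le⟩
  have hbJ : b ∈ J := hKJ ⟨hab.le, le_rfl⟩
  let η : ℝ → F := fun t => ψ t • v
  have hη : ContDiff ℝ ∞ η := hψ.smul contDiff_const
  -- The margin between `δ / 2` and `δ` makes `η` vanish near both end points, so jets of every
  -- order are kept fixed there.
  have hη0 : ∀ t, δ / 2 < |t - t₀| → η =ᶠ[𝓝 t] fun _ => 0 := fun t ht => by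
    have hcont : Continuous fun t : ℝ => |t - t₀| := by fun_prop
    filter_upwards [(isOpen_lt continuous_const hcont).mem_nhds ht] with s hs
    simp [η, hψ0 s hs]
  have hηa : η =ᶠ[𝓝 a] fun _ => 0 := hη0 a (by
    rw [ha, sub_sub_cancel_left, abs_neg, abs_of_pos hδ]; linarith)
  have hηb : η =ᶠ[𝓝 b] fun _ => 0 := hη0 b (by
    rw [hb, add_sub_cancel_left, abs_of_pos hδ]; linarith)
  -- The range of `s` is chosen so that the whole `k`-th lift of the perturbed curve, and not only
  -- the curve, stays in the chart and over `V`.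
  obtain ⟨ε, hε, hmem⟩ := exists_forall_add_smul_mem hS (Z := jetCurve k g)
    (Ψ := verticalJetCurve k η) (isCompact_Icc (a := a) (b := b))
    (fun t ht => (hZc t (hKJ ht)).continuousAt.continuousWithinAt)
    (fun t _ => (hasDerivAt_verticalJetCurve hη.contDiffAt).continuousAt.continuousWithinAt)
    (fun t ht => hZS t (hKJ ht))
  have hfirst := hasDerivAt_integral_oneForm hS hAS hab.le hε (fun t ht => hZc t (hKJ ht))
    (fun t _ => hasDerivAt_verticalJetCurve hη.contDiffAt) (hZ'c.mono hKJ)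
    (fun t _ => (continuousAt_verticalJetCurveVelocity hη.contDiffAt).continuousWithinAt)
    hmem (verticalJetCurve_eq_zero hηa) (verticalJetCurve_eq_zero hηb)
  let γ : ℝ → ℝ → F := fun s t => g t + s • η t
  have hγ : ∀ s, ∀ t ∈ J, ContDiffAt ℝ ∞ (γ s) t := fun s t ht =>
    (hgs t ht).add (contDiffAt_const.smul hη.contDiffAt)
  have hγe : ∀ s, ∀ t ∈ J, ∀ᶠ t' in 𝓝 t, ContDiffAt ℝ ∞ (γ s) t' := fun s t ht =>
    (hJ.eventually_mem ht).mono fun t' ht' => hγ s t' ht'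
  have hγZ : ∀ s, ∀ t ∈ J, jetCurve k (γ s) t = jetCurve k g t + s • verticalJetCurve k η t :=
    fun s t ht => jetCurve_add_smul (hgs t ht) hη.contDiffAt s
  have hγt : ∀ s ∈ Icc (-ε) ε, ∀ t ∈ Icc a b, γ s t ∈ e.target := fun s hs t ht => by
    have h := hmem t ht s hs
    rw [← hγZ s t (hKJ ht)] at h
    simpa [jetCurve] using jetSpace_mem_chart_target.1 h.1
  let Φ : ℝ × ℝ → M := fun q => e.symm (γ q.2 q.1)
  have hvar : IsVariation F r a b c Φ := by
    let T : ℝ × ℝ → F := fun q => γ q.2 q.1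
    have hT : ∀ q ∈ J ×ˢ (univ : Set ℝ), ContDiffAt ℝ ∞ T q := fun q hq =>
      ((hgs q.1 hq.1).comp q contDiffAt_fst).add
        (contDiffAt_snd.smul (hη.contDiffAt.comp q contDiffAt_fst))
    refine ⟨ε, (J ×ˢ (univ : Set ℝ)) ∩ T ⁻¹' e.target, hε, ?_, ?_, ?_, ?_, ?_⟩
    · exact ContinuousOn.isOpen_inter_preimage
        (fun q hq => (hT q hq).continuousAt.continuousWithinAt) (hJ.prod isOpen_univ) e.open_target
    · exact fun q hq => ⟨⟨hKJ hq.1, mem_univ _⟩, hγt q.2 hq.2 q.1 hq.1⟩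
    · intro q hq
      refine ContMDiffAt.contMDiffWithinAt ?_
      exact ContMDiffAt.comp (I' := 𝓘(ℝ, F)) q ((contMDiffOn_symm_of_mem_maximalAtlas
        (StructureGroupoid.subset_maximalAtlas _ heA)).contMDiffAt (e.open_target.mem_nhds hq.2))
        (hT q hq.1).contMDiffAt
    · intro t ht
      simp only [Φ, γ, zero_smul, add_zero]
      exact e.left_inv (hKJ ht).2
    · have hend : ∀ t ∈ J, η =ᶠ[𝓝 t] (fun _ => 0) → ∀ s,
          jet F r (fun t => Φ (t, s)) t = jet F r c t := by
        intro t ht h0 s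
        refine jet_congr (hcs t ht.1) ?_
        filter_upwards [h0, hJ.mem_nhds ht] with t' h1 h2
        simp only [Φ, γ, h1, smul_zero, add_zero]
        exact e.left_inv h2.2
      exact fun s _ => ⟨hend a haJ hηa s, hend b hbJ hηb s⟩
  have hzero := hc.stationary a b Φ hab (hKJ.trans inter_subset_left) hvar
  have haction : ∀ s ∈ Icc (-ε) ε, jetAction α a b (fun t => Φ (t, s)) =
      ∫ t in a..b, A (jetCurve k g t + s • verticalJetCurve k η t)
        ![jetCurveVelocity k g t + s • verticalJetCurveVelocity k η t] := by
    intro s hs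
    refine intervalIntegral.integral_congr fun t ht => ?_
    rw [uIcc_of_le hab.le] at ht
    have hs1 : SmoothNear F (e.symm ∘ γ s) t :=
      smoothNear_symm_comp heA (hγe s t (hKJ ht)) (hγt s hs t ht)
    have hs2 : (e.symm ∘ γ s) t ∈ (chartAt F x.point).source := e.map_target (hγt s hs t ht)
    have hs3 : e ∘ (e.symm ∘ γ s) =ᶠ[𝓝 t] γ s :=
      chart_comp_symm_comp_eventuallyEq (hγ s t (hKJ ht)).continuousAt (hγt s hs t ht)
    have hu := jet_mem_chart_source (k := k) hs2
    have hcoord : extChartAt 𝓘(ℝ, JetModel F k) x (jet F k (e.symm ∘ γ s) t) =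
        jetCurve k g t + s • verticalJetCurve k η t := by
      rw [extChartAt_jet x hs1 hs2, ← he, jetCurve_congr hs3, hγZ s t (hKJ ht)]
    have hvel : chartDeriv x _ (jetVelocity F k (e.symm ∘ γ s) t) =
        jetCurveVelocity k g t + s • verticalJetCurveVelocity k η t := by
      rw [chartDeriv_jetVelocity x hs1 hs2, ← he, jetCurveVelocity_congr hs3,
        jetCurveVelocity_add_smul (hgs t (hKJ ht)) hη.contDiffAt]
    have hin : jet F k (e.symm ∘ γ s) t ∈ V := by
      have h := (hmem t ht s hs).2
      rwa [← hcoord, mem_preimage, PartialEquiv.left_inv _ hu] at h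
    have h1 : α (jet F k (e.symm ∘ γ s) t) ![jetVelocity F k (e.symm ∘ γ s) t] =
        A (jetCurve k g t + s • verticalJetCurve k η t)
          ![jetCurveVelocity k g t + s • verticalJetCurveVelocity k η t] := by
      -- Passage from `α`, whose action is stationary, to `αo`, whose differential is controlled.
      rw [← hαo.mem_class.apply_eq hV hin (jetVelocity_mem_holonomicDistribution hs1), ← hcoord,
        ← hvel, hA, αo.inChart_chartDeriv_one hu]
    exact h1
  have hint : ∫ t in a..b, extDerivContract A (jetCurve k g t) (jetCurveVelocity k g t)
      (verticalJetCurve k η t) = 0 := by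
    refine hfirst.unique (hzero.congr_of_eventuallyEq ?_)
    filter_upwards [Icc_mem_nhds (neg_lt_zero.2 hε) hε] with s hs
    exact (haction s hs).symm
  refine Eq.trans (intervalIntegral.integral_congr fun t ht => ?_) hint
  rw [uIcc_of_le hab.le] at ht
  -- The lift of `η = ψ v` differs from `ψ` times `(0, v, 0, …)` by derivatives of `ψ` in the higher
  -- coordinates. These are tangent to the fibres over `E` and contribute nothing, so no further
  -- integration by parts occurs.
  have h1 := hαo.extDerivContract_eq_zero hV x (hcs t (hKJ ht).1) (hKJ ht).2
    (hc.lift_mem t (hKJ ht).1)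
    (w := verticalJetCurve k η t - ψ t • ((0, Pi.single 0 v) : JetModel F k))
    (by simp [verticalJetCurve]) (by simp [verticalJetCurve, η])
  rw [map_sub, map_smul, sub_eq_zero] at h1
  exact h1.symm

/-- Along a solution of the variational principle, the contraction of `dαo` with the velocity of
the lift vanishes. -/
lemma SatisfiesVariationalPrinciple.extDerivContract_eq_zero {r : ℕ}
    {V : Set (JetSpace F M k)} (hV : IsOpen V) {α αo : JetForm F M k 1}
    (hαo : IsPoincareCartanTypeOn V α αo) {I : Set ℝ} {c : ℝ → M}
    (hc : SatisfiesVariationalPrinciple r V α I c) (x : JetSpace F M k) {t : ℝ} (ht : t ∈ I)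
    (hx : c t ∈ (chartAt F x.point).source) (w : JetModel F k) :
    extDerivContract (αo.inChart x) (jetCurve k (chartAt F x.point ∘ c) t)
      (jetCurveVelocity k (chartAt F x.point ∘ c) t) w = 0 := by
  have hcs : SmoothNear F c t :=
    (hc.isOpen.eventually_mem ht).mono fun s hs => hc.smooth.contMDiffAt (hc.isOpen.mem_nhds hs)
  set z := jetCurveVelocity k (chartAt F x.point ∘ c) t with hz
  set Q := extDerivContract (αo.inChart x) (jetCurve k (chartAt F x.point ∘ c) t) z with hQ
  -- Since `z` has time component `1`, subtracting `w.1 • z` removes the time component of `w`.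
  -- Subtracting `v` then removes the `y`-component, and a vector tangent to the fibres over `E`
  -- remains.
  set v : JetModel F k := (0, Pi.single 0 (w.2 0 - w.1 • z.2 0)) with hv
  have hz1 : z.1 = 1 := rfl
  have h1 : Q (w - w.1 • z - v) = 0 :=
    hαo.extDerivContract_eq_zero hV x hcs hx (hc.lift_mem t ht) (by simp [hz1, hv]) (by simp [hv])
  have h2 : Q v = 0 := hc.extDerivContract_single_eq_zero hV hαo x ht hx _
  have h3 : Q z = 0 := extDerivContract_self _ _ _
  rw [map_sub, map_sub, map_smul, h2, h3] at h1
  simpa using h1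

end EulerLagrange

/-! ### Noether's theorem -/

theorem theorem3 {F : Type*} [NormedAddCommGroup F] [NormedSpace ℝ F] [FiniteDimensional ℝ F]
    {M : Type*} [TopologicalSpace M] [ChartedSpace F M] [IsManifold 𝓘(ℝ, F) ∞ M]
    (k r : ℕ) (hk : 1 ≤ k) (hr : r ≤ k)
    (V : Set (JetSpace F M k)) (hV : IsOpen V)
    (α αo : JetForm F M k 1) (hα : α.IsSmoothOn V) (hαr : IsOfOrderOn hr V α)
    (hαo : IsPoincareCartanTypeOn V α αo)
    (U : Set (JetSpace F M k)) (hU : IsOpen U) (hUV : U ⊆ V)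
    (X : JetField F M k) (hX : IsInfinitesimalSymmetryOn U α X) :
    IsConstantOfMotionOn r V α U (fun u => αo u ![X u]) := by
  have : CompleteSpace F := FiniteDimensional.complete ℝ F
  have hαoU : αo.IsSmoothOn U := fun x => (hαo.smooth x).mono (by gcongr)
  refine ⟨hαoU.contMDiffOn_apply_vecField hX.smooth hU, fun I c hc t ht htU => ?_⟩
  have hcs : SmoothNear F c t :=
    (hc.isOpen.eventually_mem ht).mono fun s hs => hc.smooth.contMDiffAt (hc.isOpen.mem_nhds hs)
  set x := jet F k c t with hx
  have hxc : c t ∈ (chartAt F x.point).source := by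
    rw [hx, jet_point]
    exact mem_chart_source F _
  set g := chartAt F x.point ∘ c with hg
  have hy : extChartAt 𝓘(ℝ, JetModel F k) x x = jetCurve k g t := extChartAt_jet x hcs hxc
  have hm := mem_chartDomain (mem_extChartAt_source (I := 𝓘(ℝ, JetModel F k)) x) htU
  rw [hy] at hm
  have hA : DifferentiableAt ℝ (αo.inChart x) (jetCurve k g t) :=
    (hαoU.contDiffAt hU hm.1 hm.2).differentiableAt (by simp)
  have hξ : DifferentiableAt ℝ (VecField.inChart X x) (jetCurve k g t) :=
    (hX.smooth.contDiffAt_inChart hU hm.1 hm.2).differentiableAt (by simp)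
  have hZ := hasDerivAt_jetCurve (k := k) (hcs.contDiffAt_chart (chart_mem_atlas F x.point) hxc)
  have hLie := hX.lieDeriv_jetVelocity hU hV hUV hαo.smooth hαo.mem_class hcs htU
  rw [DiffForm.lieDeriv_apply, ← hx, hy, chartDeriv_jetVelocity x hcs hxc, ← hg] at hLie
  have hEL := hc.extDerivContract_eq_zero hV hαo x ht hxc (VecField.inChart X x (jetCurve k g t))
  rw [extDerivContract_apply, extDeriv_oneForm_apply, ← hg] at hEL
  have hder := hasDerivAt_oneForm_apply (hA.hasFDerivAt.comp_hasDerivAt t hZ)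
    (hξ.hasFDerivAt.comp_hasDerivAt t hZ)
  refine (hder.congr_of_eventuallyEq ?_).congr_deriv ?_
  · filter_upwards [hcs.eventually_chart hxc] with s hs
    rw [αo.apply_vecField_eq_inChart X (jet_mem_chart_source hs.2), extChartAt_jet x hs.1 hs.2]
    rfl
  · simp only [Function.comp_apply]
    -- Cartan's formula: the derivative of `A(ξ)` equals `hLie` minus `hEL`, the common term
    -- `A[Dξ(z)]` being part of `hLie`.
    linarith
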